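/- Let $(S,h)$ be a closed, connected, oriented hyperbolic surface, written as $S=\Gamma\backslash\mathbb H^2$, where $\widetilde S=\mathbb H^2$ is the universal cover and $\Gamma\cong\pi_1(S)$ acts on $\mathbb H^2$ by deck transformations (orientation-preserving isometries, freely, properly discontinuously, with compact quotient). Let $\rho:\Gamma\to \mathrm{PSL}_2(\mathbb C)=\mathrm{Isom}^+(\mathbb H^3)$ be any homomorphism and let $\widetilde{\mathrm{Map}}_\rho$ be the set of $C^\infty$ maps $g:\widetilde S\to\mathbb H^3$ with $g\circ\gamma=\rho(\gamma)\circ g$ for all $\gamma\in\Gamma$. The $1$-Schatten energy of such a $g$ is $$F(g)=\int_S\|dg\|_1\,\omega_h,\qquad \|dg_p\|_1=\operatorname{tr}\sqrt{(dg_p)^{T}dg_p},$$ where $\omega_h$ is the area form, the adjoint is taken with respect to $h$ and the metric of $\mathbb H^3$, and the integral over $S$ is computed on a fundamental domain. A smooth isomonodromic deformation of $g\in\widetilde{\mathrm{Map}}_\rho$ is a smooth map $(t,p)\mapsto g_t(p)\in\mathbb H^3$ on $(-\varepsilon,\varepsilon)\times\widetilde S$, for some $\varepsilon>0$, with all $g_t\in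 \widetilde{\mathrm{Map}}_\rho$ and $g_0=g$. We call $g$ a critical point of $F$ if, for every such deformation, $t\mapsto F(g_t)$ is differentiable at $0$ with derivative $0$; and we call $g$ minimizing if $F(g)\le F(g')$ for all $g'\in\widetilde{\mathrm{Map}}_\rho$. Let $f\in\widetilde{\mathrm{Map}}_\rho$ be an immersion. Then: (0) every $g\in\widetilde{\mathrm{Map}}_\rho$ is homotopic to $f$ through continuous $\rho$-equivariant maps, so $\widetilde{\mathrm{Map}}_\rho$ lies in one $\rho$-equivariant homotopy class; (1) if $f$ is a critical point of $F$, then $f$ is the unique critical point of $F$ in $\widetilde{\mathrm{Map}}_\rho$, and $f$ is the strict absolute minimum: $F(f)<F(g)$ for every $g\in\widetilde{\mathrm{Map}}_\rho$ with $g\ne f$. Moreover, every such $g$ fails to be critical also in the following one-sided sense (relevant where $F$ is not differentiable): there are a smooth isomonodromic deformation $(g_t)_{|t|<\varepsilon}$ of $g$ and a constant $c>0$ with $F(g_t)\le F(g)-ct$ for all $0\le t<\varepsilon$; (2) if $f$ is minimizing, then $f$ is the unique minimizing map in $\widetilde{\mathrm{Map}}_\rho$ (hence, by (0), in its $\rho$-equivariant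 homotopy class). -/

import Mathlib

open MeasureTheory
open scoped Manifold ContDiff MatrixGroups UpperHalfPlane ComplexOrder

noncomputable section

/-! ### Hyperbolic 3-space and its group of orientation-preserving isometries -/

/-- Hyperbolic 3-space in the Hermitian model: the positive definite Hermitian `2 × 2` matrices
of determinant `1`, that is, the upper sheet of the hyperboloid `-det = -1` in the Minkowski space
of Hermitian `2 × 2` matrices. -/
abbrev HypThree : Type :=
  {X : Matrix (Fin 2) (Fin 2) ℂ // X.PosDef ∧ X.det = 1}

/-- The four matrix entries, as a vector of the normed space `Fin 2 → Fin 2 → ℂ`. -/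
def HypThree.entries (X : HypThree) : Fin 2 → Fin 2 → ℂ := fun i j => X.1 i j

/-- The Lorentzian bilinear form on Hermitian `2 × 2` matrices with quadratic form `-det`
(polarized). Its restriction to each tangent space of `HypThree` is the Riemannian metric of
constant curvature `-1`. -/
def hypThreeForm (U V : Matrix (Fin 2) (Fin 2) ℂ) : ℝ :=
  ((U * V).trace - U.trace * V.trace).re / 2

theorem hypThreeForm_comm (U V : Matrix (Fin 2) (Fin 2) ℂ) :
    hypThreeForm U V = hypThreeForm V U := by
  unfold hypThreeForm
  rw [Matrix.trace_mul_comm, mul_comm U.trace]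

theorem hypThreeForm_self (U : Matrix (Fin 2) (Fin 2) ℂ) :
    hypThreeForm U U = -U.det.re := by
  simp [hypThreeForm, Matrix.trace, Matrix.det_fin_two, Fin.sum_univ_two, Matrix.mul_apply]
  ring

/-- The group `PSL₂(ℂ)`. -/
abbrev PSLTwoC : Type := Matrix.ProjectiveSpecialLinearGroup (Fin 2) ℂ

/-- `SL₂(ℂ)` acts on `HypThree` by `A • X = A X A*`. -/
instance slTwoCAction : MulAction SL(2, ℂ) HypThree where
  smul A X := ⟨(A : Matrix (Fin 2) (Fin 2) ℂ) * X.1 * (A : Matrix (Fin 2) (Fin 2) ℂ).conjTranspose,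
    X.2.1.mul_mul_conjTranspose_same (Matrix.vecMul_injective_of_isUnit
      ((Matrix.isUnit_iff_isUnit_det _).2 (by simp))),
    by rw [Matrix.det_mul, Matrix.det_mul, Matrix.det_conjTranspose, X.2.2]; simp⟩
  one_smul X := Subtype.ext (by
    change ((1 : SL(2, ℂ)) : Matrix (Fin 2) (Fin 2) ℂ) * X.1 *
      ((1 : SL(2, ℂ)) : Matrix (Fin 2) (Fin 2) ℂ).conjTranspose = X.1
    simp)
  mul_smul A B X := Subtype.ext (by
    change ((A * B : SL(2, ℂ)) : Matrix (Fin 2) (Fin 2) ℂ) * X.1 *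
        ((A * B : SL(2, ℂ)) : Matrix (Fin 2) (Fin 2) ℂ).conjTranspose =
      (A : Matrix (Fin 2) (Fin 2) ℂ) *
        ((B : Matrix (Fin 2) (Fin 2) ℂ) * X.1 * (B : Matrix (Fin 2) (Fin 2) ℂ).conjTranspose) *
        (A : Matrix (Fin 2) (Fin 2) ℂ).conjTranspose
    simp [Matrix.conjTranspose_mul, Matrix.mul_assoc])

theorem slTwoC_smul_coe (A : SL(2, ℂ)) (X : HypThree) :
    (A • X).1 = (A : Matrix (Fin 2) (Fin 2) ℂ) * X.1 *
      (A : Matrix (Fin 2) (Fin 2) ℂ).conjTranspose := rfl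

theorem slTwoC_center_le_ker :
    Subgroup.center SL(2, ℂ) ≤ (MulAction.toPermHom SL(2, ℂ) HypThree).ker := by
  intro A hA
  obtain ⟨r, hr, hrA⟩ := Matrix.SpecialLinearGroup.mem_center_iff.1 hA
  rw [MonoidHom.mem_ker]
  ext1 X
  apply Subtype.ext
  change (A : Matrix (Fin 2) (Fin 2) ℂ) * X.1 *
      (A : Matrix (Fin 2) (Fin 2) ℂ).conjTranspose = X.1
  have h2' : r * (starRingEnd ℂ) r = 1 := by
    have : r = 1 ∨ r = -1 := by simpa using hr
    rcases this with h | h <;> simp [h]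
  rw [← hrA]
  ext i j
  simp [Matrix.scalar_apply, Matrix.diagonal_conjTranspose, Matrix.diagonal_mul,
    Matrix.mul_diagonal]
  linear_combination (X.1 i j) * h2'

/-- The action of `PSL₂(ℂ)` on hyperbolic 3-space induced by `A • X = A X A*`. -/
instance pslTwoCAction : MulAction PSLTwoC HypThree :=
  MulAction.compHom HypThree
    (QuotientGroup.lift (Subgroup.center SL(2, ℂ)) (MulAction.toPermHom SL(2, ℂ) HypThree)
      slTwoC_center_le_ker : PSLTwoC →* Equiv.Perm HypThree)

theorem pslTwoC_mk_smul (A : SL(2, ℂ)) (X : HypThree) :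
    (QuotientGroup.mk A : PSLTwoC) • X = A • X := rfl

/-! ### Closed hyperbolic surfaces

A closed oriented hyperbolic surface `(S, h)` is given as `Γ \ ℍ`: its universal cover is the
hyperbolic plane `ℍ` (upper half-plane with metric `|dz|² / y²` and area form `dx dy / y²`) and
`Γ ≅ π₁(S)` is the group of deck transformations. -/

/-- `Γ` acts on the hyperbolic plane as the deck group of a closed oriented hyperbolic surface:
by orientation-preserving isometries, freely, properly discontinuously, with compact quotient. -/
structure IsClosedHyperbolicSurface (Γ : Type*) [Group Γ] [MulAction Γ ℍ] : Prop where
  isometric : ∀ γ : Γ, ∃ A : SL(2, ℝ), ∀ z : ℍ, γ • z = A • z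
  free : ∀ (γ : Γ) (z : ℍ), γ • z = z → γ = 1
  properlyDiscontinuous : ProperlyDiscontinuousSMul Γ ℍ
  compactQuotient : CompactSpace (MulAction.orbitRel.Quotient Γ ℍ)

/-! ### Equivariant maps -/

/-- Smoothness (`C^∞`) of a map from the hyperbolic plane to hyperbolic 3-space. -/
def SmoothMap (f : ℍ → HypThree) : Prop :=
  ContMDiff 𝓘(ℝ, ℂ) 𝓘(ℝ, Fin 2 → Fin 2 → ℂ) ∞ (fun z => (f z).entries)

/-- The differential of `f` at `z`, with values in the space of matrices containing
the tangent space of `HypThree` at `f z`. -/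
def differential (f : ℍ → HypThree) (z : ℍ) : ℂ →L[ℝ] (Fin 2 → Fin 2 → ℂ) :=
  mfderiv 𝓘(ℝ, ℂ) 𝓘(ℝ, Fin 2 → Fin 2 → ℂ) (fun w => (f w).entries) z

/-- The differential has rank 2 at every point. -/
def IsImmersionMap (f : ℍ → HypThree) : Prop :=
  ∀ z : ℍ, Function.Injective (differential f z)

section

variable {Γ : Type*} [Group Γ] [MulAction Γ ℍ]

/-- `f` is equivariant for the representation `ρ`. -/
def IsEquivariant (ρ : Γ →* PSLTwoC) (f : ℍ → HypThree) : Prop :=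
  ∀ (γ : Γ) (z : ℍ), f (γ • z) = ρ γ • f z

/-- The space of smooth `ρ`-equivariant maps. -/
def equivariantMaps (ρ : Γ →* PSLTwoC) : Set (ℍ → HypThree) :=
  {f | SmoothMap f ∧ IsEquivariant ρ f}

/-- `f` and `g` are homotopic through `ρ`-equivariant maps. -/
def EquivariantlyHomotopic (ρ : Γ →* PSLTwoC) (f g : ℍ → HypThree) : Prop :=
  ∃ H : ℝ → ℍ → HypThree,
    ContinuousOn (fun q : ℝ × ℍ => H q.1 q.2) (Set.Icc 0 1 ×ˢ Set.univ) ∧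
    (∀ t ∈ Set.Icc (0 : ℝ) 1, IsEquivariant ρ (H t)) ∧ H 0 = f ∧ H 1 = g

/-- `(φ t)`, for `-ε < t < ε`, is a smooth isomonodromic deformation of `f`: a smooth path of
`ρ`-equivariant maps with `φ 0 = f`. -/
structure IsDeformation (ρ : Γ →* PSLTwoC) (f : ℍ → HypThree) (ε : ℝ)
    (φ : ℝ → ℍ → HypThree) : Prop where
  pos : 0 < ε
  smooth : ContMDiffOn (𝓘(ℝ, ℝ).prod 𝓘(ℝ, ℂ)) 𝓘(ℝ, Fin 2 → Fin 2 → ℂ) ∞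
    (fun q : ℝ × ℍ => (φ q.1 q.2).entries) (Set.Ioo (-ε) ε ×ˢ Set.univ)
  equivariant : ∀ t ∈ Set.Ioo (-ε) ε, IsEquivariant ρ (φ t)
  initial : φ 0 = f

end

/-! ### The 1-Schatten energy -/

/-- The `h`-orthonormal basis `(y ∂/∂x, y ∂/∂y)` of the tangent space of `ℍ` at `z = x + iy`. -/
def orthonormalFrame (z : ℍ) : Fin 2 → ℂ := ![(z.im : ℂ), (z.im : ℂ) * Complex.I]

/-- The matrix of `(df_z)ᵀ ∘ df_z` in the orthonormal frame at `z`, where the adjoint is taken with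
respect to the metrics of `ℍ` and `HypThree`; that is, the Gram matrix of the pulled back metric. -/
def pullbackGram (f : ℍ → HypThree) (z : ℍ) : Matrix (Fin 2) (Fin 2) ℝ :=
  Matrix.of fun i j => hypThreeForm
    (Matrix.of (differential f z (orthonormalFrame z i)))
    (Matrix.of (differential f z (orthonormalFrame z j)))

/-- The 1-Schatten norm `‖df_z‖₁ = tr √((df_z)ᵀ ∘ df_z)`. -/
def schattenNorm (f : ℍ → HypThree) (z : ℍ) : ℝ :=
  (cfc Real.sqrt (pullbackGram f z)).trace

/-- The 1-Schatten energy `F(f) = ∫_S ‖df‖₁ ω_h`, where `D` is a fundamental domain for the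
action of `π₁(S)` and `volume` is the hyperbolic area on `ℍ`. -/
def schattenEnergy (D : Set ℍ) (f : ℍ → HypThree) : ℝ :=
  ∫ z in D, schattenNorm f z

section

variable {Γ : Type*} [Group Γ] [MulAction Γ ℍ]

/-- `f` is a smooth `ρ`-equivariant map which is a critical point of the energy: for every smooth
isomonodromic deformation the energy has derivative `0` at time `0`. -/
def IsCriticalPoint (D : Set ℍ) (ρ : Γ →* PSLTwoC) (f : ℍ → HypThree) : Prop :=
  f ∈ equivariantMaps ρ ∧ ∀ (ε : ℝ) (φ : ℝ → ℍ → HypThree), IsDeformation ρ f ε φ →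
    HasDerivAt (fun t => schattenEnergy D (φ t)) 0 0

/-- `f` realizes the minimum of the energy among smooth `ρ`-equivariant maps. -/
def IsMinimizing (D : Set ℍ) (ρ : Γ →* PSLTwoC) (f : ℍ → HypThree) : Prop :=
  f ∈ equivariantMaps ρ ∧ ∀ g ∈ equivariantMaps ρ, schattenEnergy D f ≤ schattenEnergy D g

end

end

/-! Any two maps `f` and `g` are joined by the homotopy `geodMap` that moves each `f z` to `g z`
along the geodesic between them at constant speed. Geodesics commute with isometries, so the
homotopy stays equivariant, which already gives (0). The rest follows from convexity of the energy
along it.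

The convexity is pointwise. An isometry places `f z` and `g z` on the geodesic of diagonal matrices,
at distance `|d|`. For fixed `t`, the differential of the homotopy is then, in a parallel frame
along this geodesic, the sum of an axial scaling of `df` and one of `dg` (`hasDerivAt_geodPoint`,
`frameCoord_geodMap`). Components along the geodesic get the factors `1 - t` and `t`; for `d ≠ 0`,
normal components get `sinh ((1 - t) d) / sinh d` and `sinh (t d) / sinh d`, which negative
curvature makes strictly smaller for `0 < t < 1`. The nuclear norm satisfies the triangle inequality
(`pairNuclear_add_le`) and does not grow beyond the larger factor under axial scaling
(`pairNuclear_axialScale_le`), so it lies below its chord. If `df` has rank 2, its image is not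
contained in the direction of the geodesic, and the inequality is strict wherever `f z ≠ g z`.

Integration gives `schattenEnergy_geodMap_le` and `schattenEnergy_geodMap_lt`. A critical point is
minimal, since a map of smaller energy would give a deformation with negative right slope. A minimal
immersion is strictly minimal, by comparison with the midpoint of the homotopy. Every other `g`
loses energy at least linearly when deformed towards `f`, so it is not critical. -/

noncomputable section

/-! ### The nuclear norm of a pair of vectors in `ℝ³` -/

/-- The dot product of `ℝ³`. -/
def dotThree (a b : Fin 3 → ℝ) : ℝ := a 0 * b 0 + a 1 * b 1 + a 2 * b 2

/-- The nuclear norm `√(E + G + 2 √(E G - F²))` of a linear map from a Euclidean plane, in terms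
of the entries `E`, `F`, `G` of its Gram matrix. -/
def gramNuclear (E F G : ℝ) : ℝ := √(E + G + 2 * √(E * G - F ^ 2))

/-- The nuclear norm of the `3 × 2` matrix with columns `a` and `b`. -/
def pairNuclear (a b : Fin 3 → ℝ) : ℝ :=
  gramNuclear (dotThree a a) (dotThree a b) (dotThree b b)

theorem dotThree_self_nonneg (a : Fin 3 → ℝ) : 0 ≤ dotThree a a := by
  unfold dotThree; nlinarith [mul_self_nonneg (a 0), mul_self_nonneg (a 1), mul_self_nonneg (a 2)]

/-- Lagrange's identity. -/
theorem dotThree_cross (a b : Fin 3 → ℝ) :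
    dotThree a a * dotThree b b - dotThree a b ^ 2 =
      (a 1 * b 2 - a 2 * b 1) ^ 2 + (a 2 * b 0 - a 0 * b 2) ^ 2 + (a 0 * b 1 - a 1 * b 0) ^ 2 := by
  unfold dotThree; ring

/-- The triple product of `ℝ³`. -/
def tripleThree (w a b : Fin 3 → ℝ) : ℝ :=
  w 0 * (a 1 * b 2 - a 2 * b 1) + w 1 * (a 2 * b 0 - a 0 * b 2) + w 2 * (a 0 * b 1 - a 1 * b 0)

theorem tripleThree_le (w a b : Fin 3 → ℝ) (hw : dotThree w w = 1) :
    tripleThree w a b ≤ √(dotThree a a * dotThree b b - dotThree a b ^ 2) := by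
  rw [dotThree_cross]
  apply Real.le_sqrt_of_sq_le
  unfold dotThree at hw
  unfold tripleThree
  set p := a 1 * b 2 - a 2 * b 1
  set q := a 2 * b 0 - a 0 * b 2
  set r := a 0 * b 1 - a 1 * b 0
  have h : p ^ 2 + q ^ 2 + r ^ 2 - (w 0 * p + w 1 * q + w 2 * r) ^ 2 =
      (w 0 * q - w 1 * p) ^ 2 + (w 0 * r - w 2 * p) ^ 2 + (w 1 * r - w 2 * q) ^ 2 := by
    linear_combination (-(p ^ 2 + q ^ 2 + r ^ 2)) * hw
  nlinarith [sq_nonneg (w 0 * q - w 1 * p), sq_nonneg (w 0 * r - w 2 * p),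
    sq_nonneg (w 1 * r - w 2 * q)]

/-- Equality in Cauchy–Schwarz holds at the normalized cross product. If the cross product vanishes,
both sides are zero and any unit vector serves. -/
theorem exists_tripleThree_eq (a b : Fin 3 → ℝ) : ∃ w, dotThree w w = 1 ∧
    tripleThree w a b = √(dotThree a a * dotThree b b - dotThree a b ^ 2) := by
  rw [dotThree_cross]
  set p := a 1 * b 2 - a 2 * b 1 with hp
  set q := a 2 * b 0 - a 0 * b 2 with hq
  set r := a 0 * b 1 - a 1 * b 0 with hr
  set N := p ^ 2 + q ^ 2 + r ^ 2 with hN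
  have hN0 : 0 ≤ N := by positivity
  rcases hN0.eq_or_lt with h | h
  · refine ⟨![1, 0, 0], by simp [dotThree], ?_⟩
    have hp0 : p = 0 := by nlinarith [sq_nonneg p, sq_nonneg q, sq_nonneg r]
    simp [tripleThree, ← hp, ← h, hp0]
  · have hs : √N ≠ 0 := (Real.sqrt_pos.2 h).ne'
    have hs2 : √N ^ 2 = N := Real.sq_sqrt hN0
    refine ⟨![p / √N, q / √N, r / √N], ?_, ?_⟩
    · simp only [dotThree, Matrix.cons_val]
      field_simp
      rw [hs2]
    · simp only [tripleThree, Matrix.cons_val, ← hp, ← hq, ← hr]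
      field_simp
      rw [hs2]

/-- The vector of `ℝ⁴` whose square norm is `|a|² + |b|² + 2 w · (a × b)`. -/
def calibration (w a b : Fin 3 → ℝ) : EuclideanSpace ℝ (Fin 4) :=
  !₂[a 0 + (b 1 * w 2 - b 2 * w 1), a 1 + (b 2 * w 0 - b 0 * w 2), a 2 + (b 0 * w 1 - b 1 * w 0),
    dotThree b w]

theorem norm_calibration (w a b : Fin 3 → ℝ) (hw : dotThree w w = 1) :
    ‖calibration w a b‖ = √(dotThree a a + dotThree b b + 2 * tripleThree w a b) := by
  rw [EuclideanSpace.norm_eq]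
  congr 1
  simp only [Fin.sum_univ_four, Real.norm_eq_abs, sq_abs, calibration, dotThree, tripleThree,
    Matrix.cons_val] at hw ⊢
  linear_combination (b 0 ^ 2 + b 1 ^ 2 + b 2 ^ 2) * hw

theorem calibration_add (w a b a' b' : Fin 3 → ℝ) :
    calibration w (a + a') (b + b') = calibration w a b + calibration w a' b' := by
  ext i
  fin_cases i <;> simp [calibration, dotThree] <;> ring

theorem norm_calibration_le (w a b : Fin 3 → ℝ) (hw : dotThree w w = 1) :
    ‖calibration w a b‖ ≤ pairNuclear a b := by
  rw [norm_calibration w a b hw]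
  apply Real.sqrt_le_sqrt
  have := tripleThree_le w a b hw
  linarith

/-- For each unit `w` the map `calibration w` is additive and its norm is at most the nuclear norm,
with equality for a suitable `w`. The nuclear norm is thus a maximum of seminorms; the `w` that is
optimal for the sum is used for both summands. -/
theorem pairNuclear_add_le (a b a' b' : Fin 3 → ℝ) :
    pairNuclear (a + a') (b + b') ≤ pairNuclear a b + pairNuclear a' b' := by
  obtain ⟨w, hw, h⟩ := exists_tripleThree_eq (a + a') (b + b')
  have h1 : pairNuclear (a + a') (b + b') = ‖calibration w (a + a') (b + b')‖ := by
    rw [norm_calibration _ _ _ hw, h]; rfl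
  rw [h1, calibration_add]
  exact (norm_add_le _ _).trans
    (add_le_add (norm_calibration_le w a b hw) (norm_calibration_le w a' b' hw))

/-- The axial scaling `diag(r, s, s)` of `ℝ³`. -/
def axialScale (r s : ℝ) (a : Fin 3 → ℝ) : Fin 3 → ℝ := ![r * a 0, s * a 1, s * a 2]

/-- The coordinates of the cross product are multiplied by `s * s`, `r * s` and `r * s`, none of
which exceeds `r ^ 2`. -/
theorem pairNuclear_axialScale_sq_le {r s : ℝ} (hs : 0 ≤ s) (hsr : s ≤ r) (a b : Fin 3 → ℝ) :
    √(dotThree (axialScale r s a) (axialScale r s a) *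
        dotThree (axialScale r s b) (axialScale r s b) -
        dotThree (axialScale r s a) (axialScale r s b) ^ 2) ≤
      r ^ 2 * √(dotThree a a * dotThree b b - dotThree a b ^ 2) := by
  have hr : 0 ≤ r := hs.trans hsr
  rw [dotThree_cross, dotThree_cross, ← Real.sqrt_sq (sq_nonneg r), ← Real.sqrt_mul (by positivity)]
  apply Real.sqrt_le_sqrt
  simp only [axialScale, Matrix.cons_val]
  have e1 : (s * s) ^ 2 ≤ (r ^ 2) ^ 2 := by rw [sq r]; gcongr
  have e2 : (r * s) ^ 2 ≤ (r ^ 2) ^ 2 := by rw [sq r]; gcongr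
  calc _ = (s * s) ^ 2 * (a 1 * b 2 - a 2 * b 1) ^ 2 + (r * s) ^ 2 * (a 2 * b 0 - a 0 * b 2) ^ 2
        + (r * s) ^ 2 * (a 0 * b 1 - a 1 * b 0) ^ 2 := by ring
    _ ≤ (r ^ 2) ^ 2 * (a 1 * b 2 - a 2 * b 1) ^ 2 + (r ^ 2) ^ 2 * (a 2 * b 0 - a 0 * b 2) ^ 2
        + (r ^ 2) ^ 2 * (a 0 * b 1 - a 1 * b 0) ^ 2 := by gcongr
    _ = _ := by ring

theorem mul_pairNuclear {r : ℝ} (hr : 0 ≤ r) (a b : Fin 3 → ℝ) :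
    r * pairNuclear a b = √(r ^ 2 * (dotThree a a + dotThree b b) +
      2 * (r ^ 2 * √(dotThree a a * dotThree b b - dotThree a b ^ 2))) := by
  unfold pairNuclear gramNuclear
  nth_rewrite 1 [← Real.sqrt_sq hr]
  rw [← Real.sqrt_mul (sq_nonneg r)]
  congr 1
  ring

theorem pairNuclear_axialScale_le {r s : ℝ} (hs : 0 ≤ s) (hsr : s ≤ r) (a b : Fin 3 → ℝ) :
    pairNuclear (axialScale r s a) (axialScale r s b) ≤ r * pairNuclear a b := by
  rw [mul_pairNuclear (hs.trans hsr)]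
  apply Real.sqrt_le_sqrt
  have h1 := pairNuclear_axialScale_sq_le hs hsr a b
  have h2 : s ^ 2 ≤ r ^ 2 := by gcongr
  have h3 : dotThree (axialScale r s a) (axialScale r s a) +
      dotThree (axialScale r s b) (axialScale r s b) ≤ r ^ 2 * (dotThree a a + dotThree b b) := by
    simp only [axialScale, dotThree, Matrix.cons_val]
    nlinarith [mul_le_mul_of_nonneg_right h2
      (by positivity : 0 ≤ a 1 ^ 2 + a 2 ^ 2 + b 1 ^ 2 + b 2 ^ 2)]
  linarith

/-- A nonzero normal component makes the inequality between the traces `|a|² + |b|²` strict; the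
area term may remain an equality. -/
theorem pairNuclear_axialScale_lt {r s : ℝ} (hs : 0 ≤ s) (hsr : s < r) (a b : Fin 3 → ℝ)
    (h : 0 < a 1 ^ 2 + a 2 ^ 2 + b 1 ^ 2 + b 2 ^ 2) :
    pairNuclear (axialScale r s a) (axialScale r s b) < r * pairNuclear a b := by
  rw [mul_pairNuclear (hs.trans hsr.le)]
  have h1 := pairNuclear_axialScale_sq_le hs hsr.le a b
  have h2 : s ^ 2 < r ^ 2 := by gcongr
  have h3 : dotThree (axialScale r s a) (axialScale r s a) +
      dotThree (axialScale r s b) (axialScale r s b) < r ^ 2 * (dotThree a a + dotThree b b) := by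
    simp only [axialScale, dotThree, Matrix.cons_val]
    nlinarith [mul_lt_mul_of_pos_right h2 h]
  apply Real.sqrt_lt_sqrt
  · have := dotThree_self_nonneg (axialScale r s a)
    have := dotThree_self_nonneg (axialScale r s b)
    positivity
  · linarith

/-- The trace of the square root of a positive semidefinite real symmetric `2 × 2` matrix. -/
theorem trace_cfc_sqrt_fin_two (M : Matrix (Fin 2) (Fin 2) ℝ) (h01 : M 1 0 = M 0 1)
    (h0 : 0 ≤ M 0 0) (h1 : 0 ≤ M 1 1) (hd : 0 ≤ M 0 0 * M 1 1 - M 0 1 ^ 2) :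
    (cfc Real.sqrt M).trace = gramNuclear (M 0 0) (M 0 1) (M 1 1) := by
  have hM : M.IsHermitian := by
    ext i j; fin_cases i <;> fin_cases j <;> simp [h01]
  have htr : M 0 0 + M 1 1 = hM.eigenvalues 0 + hM.eigenvalues 1 := by
    have := hM.trace_eq_sum_eigenvalues
    simpa [Matrix.trace_fin_two] using this
  have hdet : M 0 0 * M 1 1 - M 0 1 ^ 2 = hM.eigenvalues 0 * hM.eigenvalues 1 := by
    have := hM.det_eq_prod_eigenvalues
    rw [Matrix.det_fin_two] at this
    simp only [Fin.prod_univ_two, h01] at this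
    rw [sq]; exact this
  -- Two reals with nonnegative sum and nonnegative product are nonnegative.
  have hl : 0 ≤ hM.eigenvalues 0 ∧ 0 ≤ hM.eigenvalues 1 := by
    set x := hM.eigenvalues 0
    set y := hM.eigenvalues 1
    constructor <;> by_contra! hlt
    · nlinarith
    · nlinarith
  have key : (cfc Real.sqrt M).trace = √(hM.eigenvalues 0) + √(hM.eigenvalues 1) := by
    rw [hM.cfc_eq, Matrix.IsHermitian.cfc, Unitary.conjStarAlgAut_apply, Matrix.trace_mul_comm,
      ← mul_assoc]
    simp
  have hsq : hM.eigenvalues 0 + hM.eigenvalues 1 + 2 * (√(hM.eigenvalues 0) * √(hM.eigenvalues 1)) =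
      (√(hM.eigenvalues 0) + √(hM.eigenvalues 1)) ^ 2 := by
    linear_combination -Real.sq_sqrt hl.1 - Real.sq_sqrt hl.2
  rw [key, gramNuclear, htr, hdet, Real.sqrt_mul hl.1, hsq, Real.sqrt_sq (by positivity)]

/-! ### The coefficient `sinh (t d) / sinh d` as a smooth function of `t` and `cosh d` -/

open FormalMultilinearSeries in
/-- The entire function `∑ uⁿ / (2n + k)!`. -/
def evenSeries (k : ℕ) : ℝ → ℝ := ofScalarsSum (fun n => ((2 * n + k).factorial : ℝ)⁻¹)

open FormalMultilinearSeries in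
theorem evenSeries_radius (k : ℕ) :
    (ofScalars ℝ (fun n => ((2 * n + k).factorial : ℝ)⁻¹)).radius = ⊤ := by
  apply ofScalars_radius_eq_top_of_tendsto
  · exact Filter.Eventually.of_forall fun n => inv_ne_zero (by positivity)
  · have h : Filter.Tendsto (fun n : ℕ => (1 : ℝ) / ((n : ℝ) + 1)) Filter.atTop (nhds 0) :=
      tendsto_one_div_add_atTop_nhds_zero_nat
    refine squeeze_zero (fun n => by positivity) (fun n => ?_) h
    have e : 2 * n.succ + k = (2 * n + k) + 1 + 1 := by omega
    have hf : ((2 * n + k).factorial : ℝ) ≠ 0 := by positivity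
    rw [e, Nat.factorial_succ, Nat.factorial_succ, Real.norm_of_nonneg (by positivity),
      Real.norm_of_nonneg (by positivity)]
    push_cast
    rw [div_le_div_iff₀ (by positivity) (by positivity)]
    field_simp
    nlinarith [(Nat.cast_nonneg n : (0 : ℝ) ≤ n), (Nat.cast_nonneg k : (0 : ℝ) ≤ k),
      mul_nonneg (Nat.cast_nonneg n : (0 : ℝ) ≤ n) (Nat.cast_nonneg k : (0 : ℝ) ≤ k)]

open FormalMultilinearSeries in
theorem evenSeries_hasFPowerSeries (k : ℕ) :
    HasFPowerSeriesOnBall (evenSeries k)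
      (ofScalars ℝ (fun n => ((2 * n + k).factorial : ℝ)⁻¹)) 0 ⊤ := by
  have := (ofScalars ℝ (fun n => ((2 * n + k).factorial : ℝ)⁻¹)).hasFPowerSeriesOnBall
    (by rw [evenSeries_radius]; simp)
  rwa [evenSeries_radius] at this

theorem evenSeries_hasSum (k : ℕ) (u : ℝ) :
    HasSum (fun n : ℕ => u ^ n / (2 * n + k).factorial) (evenSeries k u) := by
  have := (evenSeries_hasFPowerSeries k).hasSum (y := u) (by simp)
  simpa [FormalMultilinearSeries.ofScalars_apply_eq, div_eq_inv_mul, mul_comm] using this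

theorem evenSeries_contDiff (k : ℕ) : ContDiff ℝ ∞ (evenSeries k) := by
  rw [← contDiffOn_univ]
  have := (evenSeries_hasFPowerSeries k).analyticOnNhd.contDiffOn (n := ∞) (by simp)
  simpa using this

theorem evenSeries_zero_sq (x : ℝ) : evenSeries 0 (x ^ 2) = Real.cosh x := by
  have h := evenSeries_hasSum 0 (x ^ 2)
  simp only [← pow_mul, add_zero] at h
  exact h.unique (Real.hasSum_cosh x)

theorem evenSeries_one_sq (x : ℝ) : x * evenSeries 1 (x ^ 2) = Real.sinh x := by
  have h := (evenSeries_hasSum 1 (x ^ 2)).mul_left x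
  refine h.unique ?_
  have e : (fun n : ℕ => x * ((x ^ 2) ^ n / (2 * n + 1).factorial)) =
      fun n => x ^ (2 * n + 1) / (2 * n + 1).factorial := by
    funext n
    rw [← pow_mul, pow_succ]
    ring
  rw [e]
  exact Real.hasSum_sinh x

theorem evenSeries_one_pos {u : ℝ} (hu : 0 ≤ u) : 0 < evenSeries 1 u := by
  have h := evenSeries_hasSum 1 u
  have h0 := h.summable.le_tsum 0 (fun n _ => by positivity)
  rw [h.tsum_eq] at h0
  simp at h0
  linarith

theorem evenSeries_zero_hasDerivAt : HasDerivAt (evenSeries 0) 2⁻¹ 0 := by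
  have := (evenSeries_hasFPowerSeries 0).hasFPowerSeriesAt.hasDerivAt
  simpa [FormalMultilinearSeries.ofScalars_apply_eq] using this

/-- The distance is not smooth where the two points meet, but its square is. As `cosh d` is a power
series in `d²` with derivative `1/2` at `0`, the inverse function theorem expresses `d²` smoothly in
`cosh d` up to the endpoint `1`. Hence geodesic homotopies are smooth even where the two maps
coincide. -/
theorem contDiffOn_arcosh_sq : ContDiffOn ℝ ∞ (fun c => Real.arcosh c ^ 2) (Set.Ici 1) := by
  intro c hc
  rcases (show (1 : ℝ) ≤ c from hc).eq_or_lt with rfl | h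
  · have hC : ContDiffAt ℝ ∞ (evenSeries 0) 0 := (evenSeries_contDiff 0).contDiffAt
    have h0 : evenSeries 0 0 = 1 := by simpa using evenSeries_zero_sq 0
    have hs : HasStrictDerivAt (evenSeries 0) 2⁻¹ 0 :=
      hC.hasStrictDerivAt' evenSeries_zero_hasDerivAt (by simp)
    have hF := hs.hasStrictFDerivAt_equiv (by norm_num)
    have hL := hC.to_localInverse hF.hasFDerivAt (by simp)
    have hleft := hF.eventually_left_inverse
    rw [h0] at hL
    refine (hL.contDiffWithinAt (s := Set.Ici 1)).congr_of_eventuallyEq_of_mem ?_ hc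
    -- Continuity brings `arcosh c ^ 2` into the neighbourhood of `0` on which the local inverse is
    -- a left inverse.
    have hcont : Filter.Tendsto (fun c => Real.arcosh c ^ 2) (nhdsWithin 1 (Set.Ici 1))
        (nhds 0) := by
      have := (Real.continuousOn_arcosh 1 hc).tendsto.pow 2
      simpa using this
    filter_upwards [hcont.eventually hleft, self_mem_nhdsWithin] with x hx hx1
    rw [evenSeries_zero_sq, Real.cosh_arcosh hx1] at hx
    exact hx.symm
  · exact ((Real.contDiffAt_arcosh h).pow 2).contDiffWithinAt

/-- The coefficient `sinh (t d) / sinh d` where `cosh d = c`. -/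
def geodCoeff (t c : ℝ) : ℝ :=
  t * evenSeries 1 (t ^ 2 * Real.arcosh c ^ 2) / evenSeries 1 (Real.arcosh c ^ 2)

theorem geodCoeff_cosh (t : ℝ) {d : ℝ} (hd : d ≠ 0) :
    geodCoeff t (Real.cosh d) = Real.sinh (t * d) / Real.sinh d := by
  have h : Real.arcosh (Real.cosh d) ^ 2 = d ^ 2 := by
    rw [← Real.cosh_abs, Real.arcosh_cosh (abs_nonneg d), sq_abs]
  rw [geodCoeff, h, ← mul_pow, ← evenSeries_one_sq (t * d), ← evenSeries_one_sq d]
  have := (evenSeries_one_pos (sq_nonneg d)).ne'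
  field_simp

theorem geodCoeff_at_one (t : ℝ) : geodCoeff t 1 = t := by
  have := (evenSeries_one_pos (le_refl 0)).ne'
  simp [geodCoeff, this]

theorem geodCoeff_zero_left (c : ℝ) : geodCoeff 0 c = 0 := by simp [geodCoeff]

theorem geodCoeff_one_left (c : ℝ) : geodCoeff 1 c = 1 := by
  have := (evenSeries_one_pos (sq_nonneg (Real.arcosh c))).ne'
  simp [geodCoeff, this]

theorem contDiffOn_geodCoeff :
    ContDiffOn ℝ ∞ (fun q : ℝ × ℝ => geodCoeff q.1 q.2) (Set.univ ×ˢ Set.Ici 1) := by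
  have hU : ContDiffOn ℝ ∞ (fun q : ℝ × ℝ => Real.arcosh q.2 ^ 2) (Set.univ ×ˢ Set.Ici 1) :=
    contDiffOn_arcosh_sq.comp contDiff_snd.contDiffOn (fun q hq => hq.2)
  refine ContDiffOn.div ?_ ?_ (fun q _ => (evenSeries_one_pos (sq_nonneg _)).ne')
  · exact contDiff_fst.contDiffOn.mul ((evenSeries_contDiff 1).comp_contDiffOn
      ((contDiff_fst.pow 2).contDiffOn.mul hU))
  · exact (evenSeries_contDiff 1).comp_contDiffOn hU

/-- All coefficients are positive. Strictness is read off at `n = 1`, because the term `n = 0` is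
constant. -/
theorem evenSeries_one_strictMonoOn : StrictMonoOn (evenSeries 1) (Set.Ici 0) := by
  intro u hu v hv huv
  refine hasSum_lt (i := 1) (fun n => ?_) ?_ (evenSeries_hasSum 1 u) (evenSeries_hasSum 1 v)
  · have : (0 : ℝ) ≤ u := hu
    show u ^ n / _ ≤ v ^ n / _
    gcongr
  · show u ^ 1 / _ < v ^ 1 / _
    rw [pow_one, pow_one]
    gcongr

theorem geodCoeff_nonneg {t : ℝ} (ht : 0 ≤ t) (c : ℝ) : 0 ≤ geodCoeff t c :=
  div_nonneg (mul_nonneg ht (evenSeries_one_pos (by positivity)).le)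
    (evenSeries_one_pos (by positivity)).le

theorem geodCoeff_lt {t c : ℝ} (ht0 : 0 < t) (ht1 : t < 1) (hc : 1 < c) : geodCoeff t c < t := by
  have hG := evenSeries_one_pos (sq_nonneg (Real.arcosh c))
  have hu : 0 < Real.arcosh c ^ 2 := pow_pos (Real.arcosh_pos hc) 2
  have h : evenSeries 1 (t ^ 2 * Real.arcosh c ^ 2) < evenSeries 1 (Real.arcosh c ^ 2) := by
    apply evenSeries_one_strictMonoOn (show (0 : ℝ) ≤ _ by positivity) (show (0 : ℝ) ≤ _ from hu.le)
    exact mul_lt_of_lt_one_left hu (by nlinarith)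
  rw [geodCoeff, div_lt_iff₀ hG]
  exact mul_lt_mul_of_pos_left h ht0

theorem geodCoeff_le {t c : ℝ} (ht0 : 0 ≤ t) (ht1 : t ≤ 1) (hc : 1 ≤ c) : geodCoeff t c ≤ t := by
  rcases ht0.eq_or_lt with rfl | ht0
  · rw [geodCoeff_zero_left]
  rcases ht1.eq_or_lt with rfl | ht1
  · rw [geodCoeff_one_left]
  rcases hc.eq_or_lt with rfl | hc
  · rw [geodCoeff_at_one]
  · exact (geodCoeff_lt ht0 ht1 hc).le

/-! ### Geodesics of hyperbolic 3-space -/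

/-- For `2 × 2` matrices `V.adjugate = V.trace • 1 - V`. Since the adjugate reverses products,
invariance under congruence reduces to cyclicity of the trace. -/
theorem hypThreeForm_eq_adjugate (U V : Matrix (Fin 2) (Fin 2) ℂ) :
    hypThreeForm U V = -(U * V.adjugate).trace.re / 2 := by
  simp [hypThreeForm, Matrix.trace_fin_two, Matrix.adjugate_fin_two, Matrix.mul_apply,
    Fin.sum_univ_two]
  ring

/-- Congruence by a matrix of determinant one preserves the Lorentzian form. -/
theorem hypThreeForm_conj (A : SL(2, ℂ)) (U V : Matrix (Fin 2) (Fin 2) ℂ) :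
    hypThreeForm ((A : Matrix (Fin 2) (Fin 2) ℂ) * U * (A : Matrix (Fin 2) (Fin 2) ℂ).conjTranspose)
      ((A : Matrix (Fin 2) (Fin 2) ℂ) * V * (A : Matrix (Fin 2) (Fin 2) ℂ).conjTranspose) =
    hypThreeForm U V := by
  rw [hypThreeForm_eq_adjugate, hypThreeForm_eq_adjugate]
  set B : Matrix (Fin 2) (Fin 2) ℂ := (A : Matrix (Fin 2) (Fin 2) ℂ) with hB
  have hdet : B.det = 1 := A.2
  have h1 : B.conjTranspose * B.conjTranspose.adjugate = 1 := by
    rw [Matrix.mul_adjugate, Matrix.det_conjTranspose, hdet]; simp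
  have h2 : B.adjugate * B = 1 := by rw [Matrix.adjugate_mul, hdet]; simp
  have h3 : B * U * B.conjTranspose * (B * V * B.conjTranspose).adjugate =
      B * (U * V.adjugate * B.adjugate) := by
    rw [Matrix.adjugate_mul_distrib, Matrix.adjugate_mul_distrib]
    calc _ = B * U * (B.conjTranspose * B.conjTranspose.adjugate) * (V.adjugate * B.adjugate) := by
          simp only [Matrix.mul_assoc]
      _ = _ := by rw [h1]; simp only [Matrix.mul_assoc, Matrix.one_mul]
  rw [h3, Matrix.trace_mul_comm, Matrix.mul_assoc, h2, Matrix.mul_one]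

theorem hypThreeForm_add_left (U U' V : Matrix (Fin 2) (Fin 2) ℂ) :
    hypThreeForm (U + U') V = hypThreeForm U V + hypThreeForm U' V := by
  simp [hypThreeForm, add_mul]; ring

theorem hypThreeForm_smul_left (r : ℝ) (U V : Matrix (Fin 2) (Fin 2) ℂ) :
    hypThreeForm (r • U) V = r * hypThreeForm U V := by
  simp [hypThreeForm]; ring

/-- The point of the geodesic through the origin `1` with eigenvalues `exp d` and `exp (-d)`. -/
def diagHyp (d : ℝ) : HypThree :=
  ⟨Matrix.diagonal ![(Real.exp d : ℂ), (Real.exp (-d) : ℂ)], by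
    refine ⟨Matrix.PosDef.diagonal fun i => ?_, ?_⟩
    · fin_cases i <;> exact Complex.zero_lt_real.2 (Real.exp_pos _)
    · rw [Matrix.det_diagonal, Fin.prod_univ_two]
      simp only [Matrix.cons_val]
      rw [← Complex.ofReal_mul, ← Real.exp_add, add_neg_cancel, Real.exp_zero, Complex.ofReal_one]⟩

theorem exists_slTwoC_smul_coe (A : Matrix (Fin 2) (Fin 2) ℂ) (hA : A.det = 1) :
    ∃ B : SL(2, ℂ), ∀ X : HypThree, (B • X).1 = A * X.1 * A.conjTranspose :=
  ⟨(⟨A, hA⟩ : Matrix.SpecialLinearGroup (Fin 2) ℂ), fun _ => rfl⟩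

theorem exists_smul_eq_diagHyp_zero (X : HypThree) : ∃ A : SL(2, ℂ), A • X = diagHyp 0 := by
  obtain ⟨X, hX, hdet⟩ := X
  have h00 : 0 < X 0 0 := hX.diag_pos
  have h10 : X 1 0 = star (X 0 1) := (hX.isHermitian.apply 1 0).symm
  obtain ⟨s, hs, hs2⟩ : ∃ s : ℝ, 0 < s ∧ X 0 0 = (s : ℂ) ^ 2 := by
    obtain ⟨hre, him⟩ := Complex.lt_def.1 h00
    refine ⟨√(X 0 0).re, Real.sqrt_pos.2 hre, ?_⟩
    rw [← Complex.ofReal_pow, Real.sq_sqrt hre.le]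
    exact Complex.ext rfl (by simpa using him.symm)
  have hsc : (s : ℂ) ≠ 0 := by exact_mod_cast hs.ne'
  rw [Matrix.det_fin_two, h10, hs2] at hdet
  -- One step of Gaussian elimination: the lower triangular matrix clears the off-diagonal entries
  -- of `X`, and `det X = 1` leaves the identity.
  have hA : (!![(s : ℂ)⁻¹, 0; -X 1 0 / s, s]).det = 1 := by
    rw [Matrix.det_fin_two_of]
    field_simp
    ring
  obtain ⟨B, hB⟩ := exists_slTwoC_smul_coe _ hA
  refine ⟨B, Subtype.ext ?_⟩
  rw [hB]
  have hX2 : X = !![(s : ℂ) ^ 2, X 0 1; star (X 0 1), X 1 1] := by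
    rw [← hs2, ← h10]; exact Matrix.eta_fin_two X
  simp only [Complex.star_def] at hX2 h10 hdet
  rw [h10]
  change _ * X * _ = _
  rw [hX2]
  generalize X 0 1 = b at *
  generalize X 1 1 = e at *
  ext i j
  fin_cases i <;> fin_cases j <;>
    simp [diagHyp, Matrix.mul_apply, Fin.sum_univ_two]
  · field_simp
  · field_simp
    ring
  · field_simp
    simp
  · field_simp
    linear_combination hdet

theorem exists_smul_zero_smul_eq_diagHyp (Y : HypThree) :
    ∃ (A : SL(2, ℂ)) (d : ℝ), A • diagHyp 0 = diagHyp 0 ∧ A • Y = diagHyp d := by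
  obtain ⟨Y, hY, hdet⟩ := Y
  have hH := hY.isHermitian
  set U : Matrix (Fin 2) (Fin 2) ℂ :=
    (hH.eigenvectorUnitary : Matrix (Fin 2) (Fin 2) ℂ) with hU
  have hUU : U * star U = 1 := by simp [hU]
  have hUU' : star U * U = 1 := by simp [hU]
  have hl : hH.eigenvalues 0 * hH.eigenvalues 1 = 1 := by
    have := hH.det_eq_prod_eigenvalues
    rw [hdet, Fin.prod_univ_two] at this
    exact Complex.ofReal_injective (by simpa using this.symm)
  have hpos := hY.eigenvalues_pos 0
  have hspec : star U * Y * U = 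
      Matrix.diagonal ![(hH.eigenvalues 0 : ℂ), (hH.eigenvalues 1 : ℂ)] := by
    have h := hH.spectral_theorem
    rw [Unitary.conjStarAlgAut_apply] at h
    have e : (RCLike.ofReal ∘ hH.eigenvalues : Fin 2 → ℂ) =
        ![(hH.eigenvalues 0 : ℂ), (hH.eigenvalues 1 : ℂ)] := by
      ext i; fin_cases i <;> rfl
    rw [e] at h
    rw [← hU] at h
    calc star U * Y * U = star U * (U * Matrix.diagonal
          ![(hH.eigenvalues 0 : ℂ), (hH.eigenvalues 1 : ℂ)] * star U) * U := 
            congrArg (fun Z => star U * Z * U) h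
      _ = (star U * U) * Matrix.diagonal ![(hH.eigenvalues 0 : ℂ), (hH.eigenvalues 1 : ℂ)] *
          (star U * U) := by simp only [Matrix.mul_assoc]
      _ = _ := by rw [hUU']; simp
  set μ := U.det
  have hμ : μ * star μ = 1 := by
    rw [← Matrix.det_conjTranspose, ← Matrix.det_mul, ← Matrix.star_eq_conjTranspose, hUU,
      Matrix.det_one]
  -- The diagonalizing unitary matrix need not have determinant one. The unitary `D` corrects the
  -- determinant of `star U` and fixes every diagonal matrix under congruence.
  let D : Matrix (Fin 2) (Fin 2) ℂ := Matrix.diagonal ![μ, 1]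
  have hD : ∀ x y : ℂ, D * Matrix.diagonal ![x, y] * D.conjTranspose = Matrix.diagonal ![x, y] := by
    intro x y
    rw [Matrix.diagonal_conjTranspose, Matrix.diagonal_mul_diagonal, Matrix.diagonal_mul_diagonal]
    congr 1
    ext i
    fin_cases i
    · simp only [Fin.zero_eta, Matrix.cons_val_zero, Pi.star_apply]
      linear_combination x * hμ
    · simp
  have h1 : (diagHyp 0).1 = 1 := by
    ext i j; fin_cases i <;> fin_cases j <;> simp [diagHyp]
  have hA : (D * star U).det = 1 := by
    rw [Matrix.det_mul, Matrix.star_eq_conjTranspose, Matrix.det_conjTranspose, Matrix.det_diagonal]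
    simpa using hμ
  obtain ⟨B, hB⟩ := exists_slTwoC_smul_coe _ hA
  refine ⟨B, Real.log (hH.eigenvalues 0), Subtype.ext ?_, Subtype.ext ?_⟩
  · rw [hB, h1, Matrix.mul_one]
    have h := hD 1 1
    have e : Matrix.diagonal ![(1 : ℂ), 1] = 1 := by
      ext i j; fin_cases i <;> fin_cases j <;> simp
    rw [e, Matrix.mul_one] at h
    rw [Matrix.conjTranspose_mul, ← Matrix.star_eq_conjTranspose (star U), star_star]
    calc _ = D * (star U * U) * D.conjTranspose := by simp only [Matrix.mul_assoc]
      _ = 1 := by rw [hUU', Matrix.mul_one, h]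
  · rw [hB]
    rw [Matrix.conjTranspose_mul, ← Matrix.star_eq_conjTranspose (star U), star_star]
    calc _ = D * (star U * Y * U) * D.conjTranspose := by simp only [Matrix.mul_assoc]
      _ = _ := by
        rw [hspec, hD, diagHyp]
        simp only [Real.exp_neg, Real.exp_log hpos]
        rw [eq_inv_of_mul_eq_one_right hl]

/-- A normal form for pairs of points, which reduces every invariant statement about geodesics and
distances to diagonal matrices. -/
theorem exists_smul_eq_diagHyp (X Y : HypThree) :
    ∃ (A : SL(2, ℂ)) (d : ℝ), A • X = diagHyp 0 ∧ A • Y = diagHyp d := by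
  obtain ⟨A, hA⟩ := exists_smul_eq_diagHyp_zero X
  obtain ⟨B, d, hB, hBd⟩ := exists_smul_zero_smul_eq_diagHyp (A • Y)
  exact ⟨B * A, d, by rw [mul_smul, hA, hB], by rw [mul_smul, hBd]⟩

/-- The hyperbolic cosine of the distance of two points. -/
def coshDist (X Y : HypThree) : ℝ := -hypThreeForm X.1 Y.1

theorem coshDist_smul (A : SL(2, ℂ)) (X Y : HypThree) :
    coshDist (A • X) (A • Y) = coshDist X Y := by
  simp only [coshDist, slTwoC_smul_coe, hypThreeForm_conj]

theorem coshDist_diagHyp (d : ℝ) : coshDist (diagHyp 0) (diagHyp d) = Real.cosh d := by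
  simp [coshDist, hypThreeForm, diagHyp, Real.cosh_eq, Complex.exp_re]
  ring

theorem one_le_coshDist (X Y : HypThree) : 1 ≤ coshDist X Y := by
  obtain ⟨A, d, hX, hY⟩ := exists_smul_eq_diagHyp X Y
  rw [← coshDist_smul A, hX, hY, coshDist_diagHyp]
  exact Real.one_le_cosh d

/-- The linear combination `(sinh ((1-t) d) X + sinh (t d) Y) / sinh d`, where `d` is the distance
of `X` and `Y`. -/
def geodMatrix (t : ℝ) (X Y : HypThree) : Matrix (Fin 2) (Fin 2) ℂ :=
  geodCoeff (1 - t) (coshDist X Y) • X.1 + geodCoeff t (coshDist X Y) • Y.1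

theorem conj_geodMatrix (A : SL(2, ℂ)) (t : ℝ) (X Y : HypThree) :
    (A : Matrix (Fin 2) (Fin 2) ℂ) * geodMatrix t X Y *
      (A : Matrix (Fin 2) (Fin 2) ℂ).conjTranspose = geodMatrix t (A • X) (A • Y) := by
  simp only [geodMatrix, coshDist_smul, slTwoC_smul_coe, mul_add, add_mul, Matrix.mul_smul,
    Matrix.smul_mul]

theorem geodMatrix_diagHyp (t d : ℝ) :
    geodMatrix t (diagHyp 0) (diagHyp d) = (diagHyp (t * d)).1 := by
  rw [geodMatrix, coshDist_diagHyp]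
  rcases eq_or_ne d 0 with rfl | hd
  · simp only [Real.cosh_zero, geodCoeff_at_one, ← add_smul, mul_zero, sub_add_cancel, one_smul]
  · have hs : Real.sinh d ≠ 0 := by simpa using hd
    -- The two signs are the two diagonal entries; the off-diagonal entries vanish on both sides.
    have key : ∀ x : ℝ, x = d ∨ x = -d → Real.sinh ((1 - t) * d) / Real.sinh d +
        Real.sinh (t * d) / Real.sinh d * Real.exp x = Real.exp (t * x) := by
      intro x hx
      rw [div_mul_eq_mul_div, ← add_div, div_eq_iff hs, sub_mul, one_mul]
      rcases hx with rfl | rfl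
      · rw [Real.sinh_sub, ← Real.cosh_add_sinh, ← Real.cosh_add_sinh]
        ring
      · rw [Real.sinh_sub, mul_neg, ← Real.cosh_sub_sinh, ← Real.cosh_sub_sinh]
        ring
    rw [geodCoeff_cosh _ hd, geodCoeff_cosh _ hd]
    ext i j
    fin_cases i <;> fin_cases j <;> simp [diagHyp] <;> norm_cast
    · simpa using key d (Or.inl rfl)
    · simpa using key (-d) (Or.inr rfl)

theorem geodMatrix_mem (t : ℝ) (X Y : HypThree) :
    (geodMatrix t X Y).PosDef ∧ (geodMatrix t X Y).det = 1 := by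
  obtain ⟨A, d, hX, hY⟩ := exists_smul_eq_diagHyp X Y
  have h := conj_geodMatrix A⁻¹ t (diagHyp 0) (diagHyp d)
  rw [geodMatrix_diagHyp, ← hX, ← hY, inv_smul_smul, inv_smul_smul] at h
  rw [← h]
  exact (A⁻¹ • diagHyp (t * d)).2

/-- The point at time `t` on the constant speed geodesic from `X` to `Y`. -/
def geodPoint (t : ℝ) (X Y : HypThree) : HypThree := ⟨geodMatrix t X Y, geodMatrix_mem t X Y⟩

theorem geodPoint_smul (A : SL(2, ℂ)) (t : ℝ) (X Y : HypThree) :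
    geodPoint t (A • X) (A • Y) = A • geodPoint t X Y :=
  Subtype.ext (conj_geodMatrix A t X Y).symm

theorem geodPoint_smul_psl (A : PSLTwoC) (t : ℝ) (X Y : HypThree) :
    geodPoint t (A • X) (A • Y) = A • geodPoint t X Y := by
  induction A using QuotientGroup.induction_on with
  | H A => simp only [pslTwoC_mk_smul, geodPoint_smul]

theorem geodPoint_zero (X Y : HypThree) : geodPoint 0 X Y = X :=
  Subtype.ext (by simp [geodPoint, geodMatrix, geodCoeff_zero_left, geodCoeff_one_left])

theorem geodPoint_one (X Y : HypThree) : geodPoint 1 X Y = Y :=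
  Subtype.ext (by simp [geodPoint, geodMatrix, geodCoeff_zero_left, geodCoeff_one_left])

/-! ### First variation of geodesics -/

theorem geodCoeff_add_exp (t d : ℝ) :
    geodCoeff (1 - t) (Real.cosh d) + geodCoeff t (Real.cosh d) * Real.exp d =
      Real.exp (t * d) := by
  have h := congrFun (congrFun (geodMatrix_diagHyp t d) 0) 0
  rw [geodMatrix, coshDist_diagHyp] at h
  simp only [diagHyp, neg_zero, Real.exp_zero, Matrix.add_apply, Matrix.smul_apply,
    Matrix.diagonal_apply_eq, Matrix.cons_val_zero, Complex.real_smul] at h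
  rw [Complex.ofReal_one, mul_one] at h
  exact_mod_cast h

/-- The derivative of `geodCoeff t` on `[1, ∞)`. -/
def geodCoeffDeriv (t c : ℝ) : ℝ := derivWithin (geodCoeff t) (Set.Ici 1) c

theorem hasDerivWithinAt_geodCoeff (t : ℝ) {c : ℝ} (hc : 1 ≤ c) :
    HasDerivWithinAt (geodCoeff t) (geodCoeffDeriv t c) (Set.Ici 1) c := by
  have h : ContDiffOn ℝ ∞ (geodCoeff t) (Set.Ici 1) :=
    contDiffOn_geodCoeff.comp (contDiff_const.prodMk contDiff_id).contDiffOn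
      (fun x hx => ⟨Set.mem_univ t, hx⟩)
  exact ((h.differentiableOn (by simp)) c hc).hasDerivWithinAt

/-- Differentiating `geodCoeff_add_exp` in `d` yields exactly the combination of coefficient
derivatives that enters the variation of a geodesic, so no explicit formula for `geodCoeffDeriv` is
needed. -/
theorem geodCoeffDeriv_add_exp (t d : ℝ) :
    (geodCoeffDeriv (1 - t) (Real.cosh d) + geodCoeffDeriv t (Real.cosh d) * Real.exp d) *
      Real.sinh d = t * Real.exp (t * d) - geodCoeff t (Real.cosh d) * Real.exp d := by
  have hS : ∀ s, HasDerivAt (fun e => geodCoeff s (Real.cosh e))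
      (geodCoeffDeriv s (Real.cosh d) * Real.sinh d) d := fun s =>
    (hasDerivWithinAt_geodCoeff s (Real.one_le_cosh d)).comp_hasDerivAt d (Real.hasDerivAt_cosh d)
      (Filter.Eventually.of_forall fun e => Real.one_le_cosh e)
  have h1 := (hS (1 - t)).add ((hS t).mul (Real.hasDerivAt_exp d))
  have h2 : HasDerivAt (fun e => Real.exp (t * e)) (Real.exp (t * d) * (t * 1)) d :=
    ((hasDerivAt_id d).const_mul t).exp
  have h3 := h1.unique (h2.congr_of_eventuallyEq
    (Filter.Eventually.of_forall fun e => geodCoeff_add_exp t e))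
  linear_combination h3

/-- The coordinates of a tangent vector of `HypThree` at `diagHyp d`: the component along the
geodesic of diagonal matrices, and the two components normal to it. -/
def tangentCoord (d : ℝ) (V : Matrix (Fin 2) (Fin 2) ℂ) : Fin 3 → ℝ :=
  ![Real.exp (-d) * (V 0 0).re, (V 0 1).re, (V 0 1).im]

/-- Tangent vectors of `HypThree` at `diagHyp d`. -/
structure IsTangentAt (d : ℝ) (V : Matrix (Fin 2) (Fin 2) ℂ) : Prop where
  real : (V 0 0).im = 0
  symm : V 1 0 = star (V 0 1)
  diag : V 1 1 = -Real.exp (-(2 * d)) * V 0 0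

theorem IsTangentAt.eq_zero {d : ℝ} {V : Matrix (Fin 2) (Fin 2) ℂ} (hV : IsTangentAt d V)
    (h : tangentCoord d V = 0) : V = 0 := by
  have h0 := congrFun h 0
  have h1 := congrFun h 1
  have h2 := congrFun h 2
  simp [tangentCoord] at h0 h1 h2
  have e0 : V 0 0 = 0 := Complex.ext h0 hV.real
  have e1 : V 0 1 = 0 := Complex.ext h1 h2
  ext i j
  fin_cases i <;> fin_cases j
  · exact e0
  · exact e1
  · simpa [e1] using hV.symm
  · simpa [e0] using hV.diag

/-- On tangent vectors `-det V` becomes `exp (-2d) (V 0 0)² + |V 0 1|²`, so the weight `exp (-d)`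
makes the three coordinates orthonormal. -/
theorem hypThreeForm_eq_dotThree {d : ℝ} {V W : Matrix (Fin 2) (Fin 2) ℂ} (hV : IsTangentAt d V)
    (hW : IsTangentAt d W) :
    hypThreeForm V W = dotThree (tangentCoord d V) (tangentCoord d W) := by
  have h : Real.exp (-(2 * d)) = Real.exp (-d) * Real.exp (-d) := by rw [← Real.exp_add]; ring_nf
  rw [hypThreeForm]
  simp only [Matrix.trace_fin_two, Matrix.mul_apply, Fin.sum_univ_two, hV.symm, hW.symm, hV.diag,
    hW.diag, dotThree, tangentCoord, Matrix.cons_val, h]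
  generalize Real.exp (-d) = x
  simp [hV.real, hW.real]
  ring

theorem diagHyp_entries (d : ℝ) :
    (diagHyp d).entries = ![![(Real.exp d : ℂ), 0], ![0, (Real.exp (-d) : ℂ)]] := by
  ext i j
  fin_cases i <;> fin_cases j <;> simp [HypThree.entries, diagHyp]

theorem HypThree.entries_symm (X : HypThree) : X.entries 1 0 = star (X.entries 0 1) :=
  (X.2.1.isHermitian.apply 1 0).symm

theorem HypThree.entries_real (X : HypThree) : (X.entries 0 0).im = 0 :=
  Complex.conj_eq_iff_im.1 (X.2.1.isHermitian.apply 0 0)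

theorem HypThree.entries_det (X : HypThree) :
    X.entries 0 0 * X.entries 1 1 - X.entries 0 1 * X.entries 1 0 = 1 := by
  have := X.2.2
  rwa [Matrix.det_fin_two] at this

theorem hasDerivAt_entry {γ : ℝ → Fin 2 → Fin 2 → ℂ} {V : Fin 2 → Fin 2 → ℂ} {s : ℝ}
    (h : HasDerivAt γ V s) (i j : Fin 2) : HasDerivAt (fun s => γ s i j) (V i j) s :=
  hasDerivAt_pi.1 (hasDerivAt_pi.1 h i) j

/-- Velocities of curves in `HypThree` are tangent vectors. -/
theorem isTangentAt_of_hasDerivAt {X : ℝ → HypThree} {V : Fin 2 → Fin 2 → ℂ} {d : ℝ}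
    (hX : HasDerivAt (fun s => (X s).entries) V 0) (h0 : X 0 = diagHyp d) :
    IsTangentAt d (Matrix.of V) := by
  have e := hasDerivAt_entry hX
  have z00 : (X 0).entries 0 0 = Real.exp d := by rw [h0]; simp [HypThree.entries, diagHyp]
  have z01 : (X 0).entries 0 1 = 0 := by rw [h0]; simp [HypThree.entries, diagHyp]
  have z10 : (X 0).entries 1 0 = 0 := by rw [h0]; simp [HypThree.entries, diagHyp]
  have z11 : (X 0).entries 1 1 = Real.exp (-d) := by rw [h0]; simp [HypThree.entries, diagHyp]
  refine ⟨?_, ?_, ?_⟩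
  · have h1 := Complex.imCLM.hasFDerivAt.comp_hasDerivAt (0 : ℝ) (e 0 0)
    have h2 : HasDerivAt (fun _ : ℝ => (0 : ℝ)) (Complex.imCLM (V 0 0)) 0 :=
      h1.congr_of_eventuallyEq (Filter.Eventually.of_forall fun s => ((X s).entries_real).symm)
    exact h2.unique (hasDerivAt_const _ _)
  · have h1 := (e 0 1).star
    have h2 : HasDerivAt (fun s => (X s).entries 1 0) (star (V 0 1)) 0 :=
      h1.congr_of_eventuallyEq (Filter.Eventually.of_forall fun s => (X s).entries_symm)
    exact (e 1 0).unique h2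
  · have h1 := ((e 0 0).mul (e 1 1)).sub ((e 0 1).mul (e 1 0))
    have h2 := h1.congr_of_eventuallyEq (f₁ := fun _ : ℝ => (1 : ℂ))
      (Filter.Eventually.of_forall fun s => ((X s).entries_det).symm)
    have h3 := h2.unique (hasDerivAt_const _ _)
    rw [z00, z01, z10, z11] at h3
    have h4 : (Real.exp d : ℂ) * Real.exp (-d) = 1 := by
      rw [← Complex.ofReal_mul, ← Real.exp_add]; simp
    have h5 : (Real.exp (-(2 * d)) : ℂ) = Real.exp (-d) * Real.exp (-d) := by
      rw [← Complex.ofReal_mul, ← Real.exp_add]; ring_nf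
    simp only [Matrix.of_apply, h5]
    linear_combination (Real.exp (-d) : ℂ) * h3 - V 1 1 * h4

/-- First variation of distance: only the components along the geodesic count, and `cosh`
contributes the factor `sinh d`. The formula includes `d = 0`. -/
theorem hasDerivAt_coshDist {X Y : ℝ → HypThree} {V W : Fin 2 → Fin 2 → ℂ} {d : ℝ}
    (hX : HasDerivAt (fun s => (X s).entries) V 0) (hY : HasDerivAt (fun s => (Y s).entries) W 0)
    (hX0 : X 0 = diagHyp 0) (hY0 : Y 0 = diagHyp d) :
    HasDerivAt (fun s => coshDist (X s) (Y s))
      (Real.sinh d * (tangentCoord d (Matrix.of W) 0 - tangentCoord 0 (Matrix.of V) 0)) 0 := by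
  have a := hasDerivAt_entry hX
  have b := hasDerivAt_entry hY
  have tV := isTangentAt_of_hasDerivAt hX hX0
  have tW := isTangentAt_of_hasDerivAt hY hY0
  have h1 := (((((a 0 0).mul (b 1 1)).add ((a 1 1).mul (b 0 0))).sub ((a 0 1).mul (b 1 0))).sub
    ((a 1 0).mul (b 0 1))).div_const 2
  have h2 := Complex.reCLM.hasFDerivAt.comp_hasDerivAt (0 : ℝ) h1
  refine (h2.congr_of_eventuallyEq (Filter.Eventually.of_forall fun s => ?_)).congr_deriv ?_
  · simp [coshDist, hypThreeForm, Matrix.trace_fin_two, Matrix.mul_apply, Fin.sum_univ_two,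
      HypThree.entries]
    ring
  · have e1 : W 1 1 = _ := tW.diag
    have e2 : V 1 1 = _ := tV.diag
    have e3 : (W 0 0).im = 0 := tW.real
    have e4 : (V 0 0).im = 0 := tV.real
    have h5 : Real.exp (-(2 * d)) = Real.exp (-d) * Real.exp (-d) := by
      rw [← Real.exp_add]; ring_nf
    rw [e1, e2]
    simp only [hX0, hY0, Matrix.of_apply, h5]
    simp only [HypThree.entries, diagHyp, tangentCoord, Real.sinh_eq]
    have h6 : Real.exp d * Real.exp (-d) = 1 := by rw [← Real.exp_add]; simp
    generalize Real.exp (-d) = x at *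
    generalize Real.exp d = y at *
    simp [e3, e4]
    linear_combination (-(W 0 0).re / 2) * h6

/-- The derivative of the geodesic between two moving points. -/
theorem hasDerivAt_geodPoint (t : ℝ) {X Y : ℝ → HypThree} {V W : Fin 2 → Fin 2 → ℂ} {d : ℝ}
    (hX : HasDerivAt (fun s => (X s).entries) V 0) (hY : HasDerivAt (fun s => (Y s).entries) W 0)
    (hX0 : X 0 = diagHyp 0) (hY0 : Y 0 = diagHyp d) :
    ∃ Z, HasDerivAt (fun s => (geodPoint t (X s) (Y s)).entries) Z 0 ∧
      tangentCoord (t * d) (Matrix.of Z) =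
        axialScale (1 - t) (geodCoeff (1 - t) (Real.cosh d)) (tangentCoord 0 (Matrix.of V)) +
        axialScale t (geodCoeff t (Real.cosh d)) (tangentCoord d (Matrix.of W)) := by
  have hc := hasDerivAt_coshDist hX hY hX0 hY0
  have hc0 : coshDist (X 0) (Y 0) = Real.cosh d := by rw [hX0, hY0, coshDist_diagHyp]
  set δ := tangentCoord d (Matrix.of W) 0 - tangentCoord 0 (Matrix.of V) 0 with hδ
  have hS : ∀ r, HasDerivAt (fun s => geodCoeff r (coshDist (X s) (Y s)))
      (geodCoeffDeriv r (Real.cosh d) * (Real.sinh d * δ)) 0 := by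
    intro r
    have h := hasDerivWithinAt_geodCoeff r (Real.one_le_cosh d)
    rw [← hc0] at h
    have := h.comp_hasDerivAt (0 : ℝ) hc (Filter.Eventually.of_forall fun e => one_le_coshDist _ _)
    rwa [hc0] at this
  have hZ := ((hS (1 - t)).smul hX).add ((hS t).smul hY)
  refine ⟨_, hZ, ?_⟩
  rw [hX0, hY0, coshDist_diagHyp]
  have key := geodCoeffDeriv_add_exp t d
  have key2 := geodCoeff_add_exp t d
  have h4 : Real.exp (t * d) * Real.exp (-(t * d)) = 1 := by rw [← Real.exp_add]; simp
  have h5 : Real.exp d * Real.exp (-d) = 1 := by rw [← Real.exp_add]; simp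
  ext i
  fin_cases i
  -- Along the geodesic the coefficients vary too; `key` evaluates their contribution and leaves
  -- plain linear interpolation.
  · simp only [tangentCoord, axialScale, diagHyp_entries] at hδ ⊢
    generalize Real.exp (-(t * d)) = T at *
    generalize Real.exp (t * d) = E at *
    generalize Real.exp (-d) = x at *
    generalize Real.exp d = y at *
    generalize Real.sinh d = S at *
    simp [Matrix.vecHead] at hδ ⊢
    linear_combination T * δ * key + T * (t * E - geodCoeff t (Real.cosh d) * y) * hδ +
      T * (V 0 0).re * key2 - T * geodCoeff t (Real.cosh d) * (W 0 0).re * h5 +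
      ((V 0 0).re + t * (x * (W 0 0).re - (V 0 0).re)) * h4
  -- In the normal directions the varying coefficients multiply vanishing off-diagonal entries, so
  -- only the scaled velocities remain.
  · simp [tangentCoord, axialScale, HypThree.entries, diagHyp]
  · simp [tangentCoord, axialScale, HypThree.entries, diagHyp]

open UpperHalfPlane

/-! ### Smooth maps on the hyperbolic plane in the coordinate of `ℂ` -/

/-- The matrix entries of `f` as a function on `ℂ`. -/
def planeEntries (f : ℍ → HypThree) (w : ℂ) : Fin 2 → Fin 2 → ℂ := (f (ofComplex w)).entries

theorem contMDiffAt_ofComplex_real {z : ℂ} (hz : 0 < z.im) :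
    ContMDiffAt 𝓘(ℝ, ℂ) 𝓘(ℝ, ℂ) ∞ ofComplex z := by
  rw [_root_.contMDiffAt_iff]
  constructor
  · rw [ContinuousAt, nhds_induced, Filter.tendsto_comap_iff]
    refine Filter.Tendsto.congr' (eventuallyEq_coe_comp_ofComplex hz).symm ?_
    simpa [ofComplex_apply_of_im_pos hz] using! Filter.tendsto_id
  · simpa using! contDiffAt_id.congr_of_eventuallyEq (eventuallyEq_coe_comp_ofComplex hz)

theorem SmoothMap.contDiffAt {f : ℍ → HypThree} (hf : SmoothMap f) (z : ℍ) :
    ContDiffAt ℝ ∞ (planeEntries f) z := by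
  rw [← contMDiffAt_iff_contDiffAt]
  exact ((ofComplex_apply z).symm ▸ hf z :).comp (z : ℂ) (contMDiffAt_ofComplex_real z.im_pos)

theorem SmoothMap.differential_eq {f : ℍ → HypThree} (hf : SmoothMap f) (z : ℍ) :
    differential f z = fderiv ℝ (planeEntries f) z := by
  have h : MDifferentiableAt 𝓘(ℝ, ℂ) 𝓘(ℝ, Fin 2 → Fin 2 → ℂ) (fun w => (f w).entries) z :=
    (hf z).mdifferentiableAt (by simp)
  have h2 := h.mfderiv
  rw [ModelWithCorners.range_eq_univ, fderivWithin_univ] at h2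
  exact h2

theorem SmoothMap.hasFDerivAt {f : ℍ → HypThree} (hf : SmoothMap f) (z : ℍ) :
    HasFDerivAt (planeEntries f) (differential f z) (z : ℂ) := by
  rw [hf.differential_eq]
  exact ((hf.contDiffAt z).differentiableAt (by simp)).hasFDerivAt

theorem SmoothMap.continuous {f : ℍ → HypThree} (hf : SmoothMap f) : Continuous f := by
  have h : Continuous (fun z => (f z).entries) := ContMDiff.continuous hf
  exact continuous_induced_rng.2 h

/-- Congruence of matrices by `A`, as a continuous linear map. -/
def congruence (A : SL(2, ℂ)) : (Fin 2 → Fin 2 → ℂ) →L[ℝ] (Fin 2 → Fin 2 → ℂ) :=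
  LinearMap.toContinuousLinearMap
    { toFun := fun U => (A : Matrix (Fin 2) (Fin 2) ℂ) * Matrix.of U *
        (A : Matrix (Fin 2) (Fin 2) ℂ).conjTranspose
      map_add' := fun U V => by
        rw [← Matrix.of_add_of, mul_add, add_mul]; rfl
      map_smul' := fun r U => by
        rw [← Matrix.smul_of, Matrix.mul_smul, Matrix.smul_mul]; rfl }

theorem of_congruence (A : SL(2, ℂ)) (U : Fin 2 → Fin 2 → ℂ) :
    Matrix.of (congruence A U) = (A : Matrix (Fin 2) (Fin 2) ℂ) * Matrix.of U *
      (A : Matrix (Fin 2) (Fin 2) ℂ).conjTranspose := rfl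

theorem congruence_entries (A : SL(2, ℂ)) (X : HypThree) :
    congruence A X.entries = (A • X).entries := rfl

theorem congruence_injective (A : SL(2, ℂ)) : Function.Injective (congruence A) := by
  apply Function.LeftInverse.injective (g := congruence A⁻¹)
  intro U
  apply Matrix.of.injective
  rw [of_congruence, of_congruence]
  have h : ((A⁻¹ : SL(2, ℂ)) : Matrix (Fin 2) (Fin 2) ℂ) * (A : Matrix (Fin 2) (Fin 2) ℂ) = 1 := by
    rw [← Matrix.SpecialLinearGroup.coe_mul, inv_mul_cancel, Matrix.SpecialLinearGroup.coe_one]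
  have h' := congrArg Matrix.conjTranspose h
  rw [Matrix.conjTranspose_mul, Matrix.conjTranspose_one] at h'
  calc _ = ((A⁻¹ : SL(2, ℂ)) : Matrix (Fin 2) (Fin 2) ℂ) * (A : Matrix (Fin 2) (Fin 2) ℂ) *
        Matrix.of U * ((A : Matrix (Fin 2) (Fin 2) ℂ).conjTranspose *
          ((A⁻¹ : SL(2, ℂ)) : Matrix (Fin 2) (Fin 2) ℂ).conjTranspose) := by
        simp only [Matrix.mul_assoc]
    _ = _ := by rw [h, h']; simp

/-- The curve `s ↦ A • f (z + s v)` has velocity `A (df v) A*`. -/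
theorem SmoothMap.hasDerivAt_smul {f : ℍ → HypThree} (hf : SmoothMap f) (A : SL(2, ℂ)) (z : ℍ)
    (v : ℂ) : HasDerivAt (fun s : ℝ => (A • f (ofComplex ((z : ℂ) + s • v))).entries)
      (congruence A (differential f z v)) 0 := by
  have h1 : HasDerivAt (fun s : ℝ => (z : ℂ) + s • v) v 0 := by
    simpa using ((hasDerivAt_id (0 : ℝ)).smul_const v).const_add (z : ℂ)
  have h2 : HasFDerivAt (planeEntries f) (differential f z) ((z : ℂ) + (0 : ℝ) • v) := by
    simpa using hf.hasFDerivAt z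
  have h3 : HasDerivAt (fun s : ℝ => planeEntries f ((z : ℂ) + s • v)) (differential f z v) 0 :=
    HasFDerivAt.comp_hasDerivAt (l := planeEntries f) (f := fun s : ℝ => (z : ℂ) + s • v)
      (0 : ℝ) h2 h1
  exact (congruence A).hasFDerivAt.comp_hasDerivAt (0 : ℝ) h3

/-- The coordinates of `df v` after moving `f z` to the diagonal geodesic by `A`. -/
def frameCoord (f : ℍ → HypThree) (z : ℍ) (A : SL(2, ℂ)) (d : ℝ) (v : ℂ) : Fin 3 → ℝ :=
  tangentCoord d (Matrix.of (congruence A (differential f z v)))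

theorem SmoothMap.isTangentAt {f : ℍ → HypThree} (hf : SmoothMap f) {z : ℍ} {A : SL(2, ℂ)} {d : ℝ}
    (hA : A • f z = diagHyp d) (v : ℂ) :
    IsTangentAt d (Matrix.of (congruence A (differential f z v))) :=
  isTangentAt_of_hasDerivAt (hf.hasDerivAt_smul A z v) (by simpa using hA)

theorem SmoothMap.pullbackGram_eq {f : ℍ → HypThree} (hf : SmoothMap f) {z : ℍ} {A : SL(2, ℂ)}
    {d : ℝ} (hA : A • f z = diagHyp d) (i j : Fin 2) :
    pullbackGram f z i j = dotThree (frameCoord f z A d (orthonormalFrame z i))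
      (frameCoord f z A d (orthonormalFrame z j)) := by
  rw [frameCoord, frameCoord,
    ← hypThreeForm_eq_dotThree (hf.isTangentAt hA _) (hf.isTangentAt hA _),
    of_congruence, of_congruence, hypThreeForm_conj]
  rfl

theorem pullbackGram_symm (f : ℍ → HypThree) (z : ℍ) (i j : Fin 2) :
    pullbackGram f z i j = pullbackGram f z j i := hypThreeForm_comm _ _

theorem SmoothMap.schattenNorm_eq_gramNuclear {f : ℍ → HypThree} (hf : SmoothMap f) (z : ℍ) :
    schattenNorm f z =
      gramNuclear (pullbackGram f z 0 0) (pullbackGram f z 0 1) (pullbackGram f z 1 1) := by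
  obtain ⟨A, hA⟩ := exists_smul_eq_diagHyp_zero (f z)
  refine trace_cfc_sqrt_fin_two _ (pullbackGram_symm f z 1 0) ?_ ?_ ?_
  · rw [hf.pullbackGram_eq hA]; exact dotThree_self_nonneg _
  · rw [hf.pullbackGram_eq hA]; exact dotThree_self_nonneg _
  · rw [hf.pullbackGram_eq hA, hf.pullbackGram_eq hA, hf.pullbackGram_eq hA, dotThree_cross]
    positivity

theorem SmoothMap.schattenNorm_eq_pairNuclear {f : ℍ → HypThree} (hf : SmoothMap f) {z : ℍ}
    {A : SL(2, ℂ)} {d : ℝ} (hA : A • f z = diagHyp d) :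
    schattenNorm f z = pairNuclear (frameCoord f z A d (orthonormalFrame z 0))
      (frameCoord f z A d (orthonormalFrame z 1)) := by
  rw [hf.schattenNorm_eq_gramNuclear, hf.pullbackGram_eq hA, hf.pullbackGram_eq hA,
    hf.pullbackGram_eq hA, pairNuclear]

/-! ### The geodesic homotopy of two smooth maps -/

/-- The geodesic homotopy from `f` to `g`. -/
def geodMap (f g : ℍ → HypThree) (t : ℝ) (z : ℍ) : HypThree := geodPoint t (f z) (g z)

/-- The entries of `geodPoint`, as a function of the entries. -/
def geodEntries (q : ℝ × (Fin 2 → Fin 2 → ℂ) × (Fin 2 → Fin 2 → ℂ)) : Fin 2 → Fin 2 → ℂ :=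
  geodCoeff (1 - q.1) (-hypThreeForm (Matrix.of q.2.1) (Matrix.of q.2.2)) • q.2.1 +
    geodCoeff q.1 (-hypThreeForm (Matrix.of q.2.1) (Matrix.of q.2.2)) • q.2.2

theorem contDiff_hypThreeForm :
    ContDiff ℝ ∞ (fun q : ℝ × (Fin 2 → Fin 2 → ℂ) × (Fin 2 → Fin 2 → ℂ) =>
      -hypThreeForm (Matrix.of q.2.1) (Matrix.of q.2.2)) := by
  simp only [hypThreeForm, Matrix.trace_fin_two, Matrix.mul_apply, Fin.sum_univ_two,
    Matrix.of_apply]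
  apply ContDiff.neg
  apply ContDiff.div_const
  refine ContDiff.comp (g := Complex.re) Complex.reCLM.contDiff ?_
  fun_prop

theorem contDiffOn_geodCoeff_entries {r : ℝ × (Fin 2 → Fin 2 → ℂ) × (Fin 2 → Fin 2 → ℂ) → ℝ}
    (hr : ContDiff ℝ ∞ r) :
    ContDiffOn ℝ ∞ (fun q : ℝ × (Fin 2 → Fin 2 → ℂ) × (Fin 2 → Fin 2 → ℂ) =>
      geodCoeff (r q) (-hypThreeForm (Matrix.of q.2.1) (Matrix.of q.2.2)))
      {q | 1 ≤ -hypThreeForm (Matrix.of q.2.1) (Matrix.of q.2.2)} := by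
  have h := hr.prodMk contDiff_hypThreeForm
  exact contDiffOn_geodCoeff.comp h.contDiffOn (fun q hq => ⟨Set.mem_univ _, hq⟩)

/-- Smoothness within this set suffices, although it is not open: by `one_le_coshDist` it contains
the entries of every pair of points of `HypThree`. -/
theorem contDiffOn_geodEntries : ContDiffOn ℝ ∞ geodEntries
    {q | 1 ≤ -hypThreeForm (Matrix.of q.2.1) (Matrix.of q.2.2)} := by
  have h1 : ContDiff ℝ ∞ (fun q : ℝ × (Fin 2 → Fin 2 → ℂ) × (Fin 2 → Fin 2 → ℂ) => q.2.1) := by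
    fun_prop
  have h2 : ContDiff ℝ ∞ (fun q : ℝ × (Fin 2 → Fin 2 → ℂ) × (Fin 2 → Fin 2 → ℂ) => q.2.2) := by
    fun_prop
  have c1 := contDiffOn_geodCoeff_entries (contDiff_const.sub contDiff_fst : ContDiff ℝ ∞
    (fun q : ℝ × (Fin 2 → Fin 2 → ℂ) × (Fin 2 → Fin 2 → ℂ) => 1 - q.1))
  have c2 := contDiffOn_geodCoeff_entries (contDiff_fst : ContDiff ℝ ∞
    (fun q : ℝ × (Fin 2 → Fin 2 → ℂ) × (Fin 2 → Fin 2 → ℂ) => q.1))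
  exact (c1.smul h1.contDiffOn).add (c2.smul h2.contDiffOn)

theorem geodMap_entries (f g : ℍ → HypThree) (t : ℝ) (z : ℍ) :
    (geodMap f g t z).entries = geodEntries (t, (f z).entries, (g z).entries) := rfl

theorem contMDiff_geodMap {f g : ℍ → HypThree} (hf : SmoothMap f) (hg : SmoothMap g) :
    ContMDiff (𝓘(ℝ, ℝ).prod 𝓘(ℝ, ℂ)) 𝓘(ℝ, Fin 2 → Fin 2 → ℂ) ∞
      (fun q : ℝ × ℍ => (geodMap f g q.1 q.2).entries) := by
  have hf2 : ContMDiff (𝓘(ℝ, ℝ).prod 𝓘(ℝ, ℂ)) 𝓘(ℝ, Fin 2 → Fin 2 → ℂ) ∞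
      (fun q : ℝ × ℍ => (f q.2).entries) :=
    ContMDiff.comp (g := fun z : ℍ => (f z).entries) hf contMDiff_snd
  have hg2 : ContMDiff (𝓘(ℝ, ℝ).prod 𝓘(ℝ, ℂ)) 𝓘(ℝ, Fin 2 → Fin 2 → ℂ) ∞
      (fun q : ℝ × ℍ => (g q.2).entries) :=
    ContMDiff.comp (g := fun z : ℍ => (g z).entries) hg contMDiff_snd
  have h1 : ContMDiff (𝓘(ℝ, ℝ).prod 𝓘(ℝ, ℂ))
      𝓘(ℝ, ℝ × (Fin 2 → Fin 2 → ℂ) × (Fin 2 → Fin 2 → ℂ)) ∞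
      (fun q : ℝ × ℍ => (q.1, (f q.2).entries, (g q.2).entries)) :=
    contMDiff_fst.prodMk_space (hf2.prodMk_space hg2)
  simp only [geodMap_entries]
  rw [← contMDiffOn_univ] at h1 ⊢
  exact ContMDiffOn.comp (g := geodEntries) contDiffOn_geodEntries.contMDiffOn h1
    (fun q _ => one_le_coshDist (f q.2) (g q.2))

theorem smoothMap_geodMap {f g : ℍ → HypThree} (hf : SmoothMap f) (hg : SmoothMap g) (t : ℝ) :
    SmoothMap (geodMap f g t) := by
  have h : ContMDiff 𝓘(ℝ, ℂ) (𝓘(ℝ, ℝ).prod 𝓘(ℝ, ℂ)) ∞ (fun z : ℍ => (t, z)) :=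
    contMDiff_const.prodMk contMDiff_id
  have h2 : ContMDiff 𝓘(ℝ, ℂ) 𝓘(ℝ, Fin 2 → Fin 2 → ℂ) ∞
      ((fun q : ℝ × ℍ => (geodMap f g q.1 q.2).entries) ∘ fun z : ℍ => (t, z)) :=
    (contMDiff_geodMap hf hg).comp h
  exact h2

theorem frameCoord_geodMap {f g : ℍ → HypThree} (hf : SmoothMap f) (hg : SmoothMap g) (t : ℝ)
    {z : ℍ} {A : SL(2, ℂ)} {d : ℝ} (hA : A • f z = diagHyp 0) (hB : A • g z = diagHyp d) (v : ℂ) :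
    frameCoord (geodMap f g t) z A (t * d) v =
      axialScale (1 - t) (geodCoeff (1 - t) (Real.cosh d)) (frameCoord f z A 0 v) +
        axialScale t (geodCoeff t (Real.cosh d)) (frameCoord g z A d v) := by
  obtain ⟨Z, hZ, h⟩ := hasDerivAt_geodPoint t (hf.hasDerivAt_smul A z v) (hg.hasDerivAt_smul A z v)
    (by simpa using hA) (by simpa using hB)
  rw [frameCoord, frameCoord, frameCoord, ← h]
  have h2 := (smoothMap_geodMap hf hg t).hasDerivAt_smul A z v
  simp only [geodMap, ← geodPoint_smul] at h2
  rw [h2.unique hZ]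

theorem smul_geodMap {f g : ℍ → HypThree} (t : ℝ) {z : ℍ} {A : SL(2, ℂ)} {d : ℝ}
    (hA : A • f z = diagHyp 0) (hB : A • g z = diagHyp d) :
    A • geodMap f g t z = diagHyp (t * d) := by
  rw [geodMap, ← geodPoint_smul, hA, hB]
  exact Subtype.ext (geodMatrix_diagHyp t d)

/-- The 1-Schatten norm is convex along geodesic homotopies. -/
theorem schattenNorm_geodMap_le {f g : ℍ → HypThree} (hf : SmoothMap f) (hg : SmoothMap g) {t : ℝ}
    (ht0 : 0 ≤ t) (ht1 : t ≤ 1) (z : ℍ) :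
    schattenNorm (geodMap f g t) z ≤ (1 - t) * schattenNorm f z + t * schattenNorm g z := by
  obtain ⟨A, d, hA, hB⟩ := exists_smul_eq_diagHyp (f z) (g z)
  rw [(smoothMap_geodMap hf hg t).schattenNorm_eq_pairNuclear (smul_geodMap t hA hB),
    hf.schattenNorm_eq_pairNuclear hA, hg.schattenNorm_eq_pairNuclear hB,
    frameCoord_geodMap hf hg t hA hB, frameCoord_geodMap hf hg t hA hB]
  have hc := Real.one_le_cosh d
  exact (pairNuclear_add_le _ _ _ _).trans (add_le_add
    (pairNuclear_axialScale_le (geodCoeff_nonneg (by linarith) _)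
      (geodCoeff_le (by linarith) (by linarith) hc) _ _)
    (pairNuclear_axialScale_le (geodCoeff_nonneg ht0 _) (geodCoeff_le ht0 ht1 hc) _ _))

theorem frameCoord_smul_sub (f : ℍ → HypThree) (z : ℍ) (A : SL(2, ℂ)) (d r s : ℝ) (v w : ℂ) :
    frameCoord f z A d (r • v - s • w) = r • frameCoord f z A d v - s • frameCoord f z A d w := by
  simp only [frameCoord, map_sub, map_smul]
  ext i
  fin_cases i <;> simp [tangentCoord]
  ring

theorem eq_zero_of_frameCoord_eq_zero {f : ℍ → HypThree} (hf : SmoothMap f) {z : ℍ}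
    (himm : Function.Injective (differential f z)) {A : SL(2, ℂ)} {d : ℝ}
    (hA : A • f z = diagHyp d) {v : ℂ} (hv : frameCoord f z A d v = 0) : v = 0 := by
  have h1 : congruence A (differential f z v) = congruence A 0 := by
    rw [map_zero]
    exact Matrix.of.injective ((hf.isTangentAt hA v).eq_zero hv)
  exact himm ((congruence_injective A h1).trans (map_zero _).symm)

/-- An immersion is not tangent to a geodesic in all directions. -/
theorem frameCoord_normal_pos {f : ℍ → HypThree} (hf : SmoothMap f) {z : ℍ}
    (himm : Function.Injective (differential f z)) {A : SL(2, ℂ)} {d : ℝ}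
    (hA : A • f z = diagHyp d) :
    0 < frameCoord f z A d (orthonormalFrame z 0) 1 ^ 2 +
      frameCoord f z A d (orthonormalFrame z 0) 2 ^ 2 +
      frameCoord f z A d (orthonormalFrame z 1) 1 ^ 2 +
      frameCoord f z A d (orthonormalFrame z 1) 2 ^ 2 := by
  by_contra! hle
  set a := frameCoord f z A d (orthonormalFrame z 0) with ha
  set b := frameCoord f z A d (orthonormalFrame z 1) with hb
  have ha1 : a 1 = 0 := by
    nlinarith [sq_nonneg (a 1), sq_nonneg (a 2), sq_nonneg (b 1), sq_nonneg (b 2)]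
  have ha2 : a 2 = 0 := by
    nlinarith [sq_nonneg (a 1), sq_nonneg (a 2), sq_nonneg (b 1), sq_nonneg (b 2)]
  have hb1 : b 1 = 0 := by
    nlinarith [sq_nonneg (a 1), sq_nonneg (a 2), sq_nonneg (b 1), sq_nonneg (b 2)]
  have hb2 : b 2 = 0 := by
    nlinarith [sq_nonneg (a 1), sq_nonneg (a 2), sq_nonneg (b 1), sq_nonneg (b 2)]
  have hz := z.im_pos.ne'
  -- If the normal components vanish, this combination of frame vectors lies in the kernel of the
  -- differential.
  have h0 : b 0 • orthonormalFrame z 0 - a 0 • orthonormalFrame z 1 = 0 := by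
    apply eq_zero_of_frameCoord_eq_zero hf himm hA
    rw [frameCoord_smul_sub, ← ha, ← hb]
    ext i
    fin_cases i
    · exact sub_eq_zero.2 (mul_comm (b 0) (a 0))
    · simp [ha1, hb1]
    · simp [ha2, hb2]
  have ha0 : a 0 = 0 := by
    have := congrArg Complex.im h0
    simpa [orthonormalFrame, hz] using this
  have h1 : orthonormalFrame z 0 = 0 := by
    apply eq_zero_of_frameCoord_eq_zero hf himm hA
    rw [← ha]
    ext i
    fin_cases i <;> simp [ha0, ha1, ha2]
  simp [orthonormalFrame, hz] at h1

/-- The 1-Schatten norm is strictly convex along geodesic homotopies that start at an immersion,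
wherever they move. -/
theorem schattenNorm_geodMap_lt {f g : ℍ → HypThree} (hf : SmoothMap f) (hg : SmoothMap g) {t : ℝ}
    (ht0 : 0 < t) (ht1 : t < 1) {z : ℍ} (himm : Function.Injective (differential f z))
    (hne : f z ≠ g z) :
    schattenNorm (geodMap f g t) z < (1 - t) * schattenNorm f z + t * schattenNorm g z := by
  obtain ⟨A, d, hA, hB⟩ := exists_smul_eq_diagHyp (f z) (g z)
  rw [(smoothMap_geodMap hf hg t).schattenNorm_eq_pairNuclear (smul_geodMap t hA hB),
    hf.schattenNorm_eq_pairNuclear hA, hg.schattenNorm_eq_pairNuclear hB,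
    frameCoord_geodMap hf hg t hA hB, frameCoord_geodMap hf hg t hA hB]
  have hd : d ≠ 0 := by
    rintro rfl
    exact hne (MulAction.injective A (hA.trans hB.symm))
  have hc := Real.one_lt_cosh.2 hd
  exact (pairNuclear_add_le _ _ _ _).trans_lt (add_lt_add_of_lt_of_le
    (pairNuclear_axialScale_lt (geodCoeff_nonneg (by linarith) _)
      (geodCoeff_lt (by linarith) (by linarith) hc) _ _ (frameCoord_normal_pos hf himm hA))
    (pairNuclear_axialScale_le (geodCoeff_nonneg ht0.le _) (geodCoeff_le ht0.le ht1.le hc.le) _ _))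

/-! ### Invariance of the 1-Schatten norm under the deck group -/

theorem SmoothMap.continuous_differential {f : ℍ → HypThree} (hf : SmoothMap f) :
    Continuous (differential f) := by
  rw [continuous_iff_continuousAt]
  intro z
  have h : ContinuousAt (fun w : ℍ => fderiv ℝ (planeEntries f) (w : ℂ)) z :=
    ((hf.contDiffAt z).continuousAt_fderiv (by simp)).comp continuous_coe.continuousAt
  exact h.congr (Filter.Eventually.of_forall fun w => (hf.differential_eq w).symm)

theorem SmoothMap.continuous_pullbackGram {f : ℍ → HypThree} (hf : SmoothMap f) (i j : Fin 2) :
    Continuous (fun z => pullbackGram f z i j) := by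
  have hD := hf.continuous_differential
  have hfr : ∀ i, Continuous (fun z : ℍ => orthonormalFrame z i) := by
    intro i
    have := Complex.continuous_ofReal.comp UpperHalfPlane.continuous_im
    fin_cases i
    · exact this
    · exact this.mul continuous_const
  have hL : ∀ i a b, Continuous (fun z : ℍ => differential f z (orthonormalFrame z i) a b) :=
    fun i a b => (continuous_apply b).comp ((continuous_apply a).comp (hD.clm_apply (hfr i)))
  simp only [pullbackGram, hypThreeForm, Matrix.trace_fin_two, Matrix.mul_apply, Fin.sum_univ_two,
    Matrix.of_apply]
  refine Continuous.div_const (Complex.continuous_re.comp ?_) _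
  have := hL
  fun_prop

theorem SmoothMap.continuous_schattenNorm {f : ℍ → HypThree} (hf : SmoothMap f) :
    Continuous (schattenNorm f) := by
  have h : schattenNorm f = fun z => gramNuclear (pullbackGram f z 0 0) (pullbackGram f z 0 1)
      (pullbackGram f z 1 1) := funext hf.schattenNorm_eq_gramNuclear
  rw [h]
  have h0 := hf.continuous_pullbackGram 0 0
  have h1 := hf.continuous_pullbackGram 0 1
  have h2 := hf.continuous_pullbackGram 1 1
  unfold gramNuclear
  fun_prop

/-- The nuclear norm is invariant under rotations of the source. -/
theorem gramNuclear_rotate (E F G c s : ℝ) (h : c ^ 2 + s ^ 2 = 1) :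
    gramNuclear (c ^ 2 * E + 2 * c * s * F + s ^ 2 * G)
      (-(c * s) * E + (c ^ 2 - s ^ 2) * F + c * s * G)
      (s ^ 2 * E - 2 * c * s * F + c ^ 2 * G) = gramNuclear E F G := by
  have h1 : (c ^ 2 * E + 2 * c * s * F + s ^ 2 * G) * (s ^ 2 * E - 2 * c * s * F + c ^ 2 * G) -
      (-(c * s) * E + (c ^ 2 - s ^ 2) * F + c * s * G) ^ 2 = E * G - F ^ 2 := by
    linear_combination (E * G - F ^ 2) * (c ^ 2 + s ^ 2 + 1) * h
  have h2 : (c ^ 2 * E + 2 * c * s * F + s ^ 2 * G) + (s ^ 2 * E - 2 * c * s * F + c ^ 2 * G) =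
      E + G := by
    linear_combination (E + G) * h
  rw [gramNuclear, gramNuclear, h1, h2]

theorem SmoothMap.differential_smul {f : ℍ → HypThree} (hf : SmoothMap f) {A : SL(2, ℝ)}
    {B : SL(2, ℂ)} (hAB : ∀ z, f (A • z) = B • f z) (z : ℍ) (v : ℂ) :
    differential f (A • z) ((denom (A : GL (Fin 2) ℝ) z ^ 2)⁻¹ * v) =
      congruence B (differential f z v) := by
  have hdet : 0 < ((A : GL (Fin 2) ℝ) : Matrix (Fin 2) (Fin 2) ℝ).det := by simp
  have h1 := ((hasStrictDerivAt_smul hdet z).hasDerivAt.hasFDerivAt.restrictScalars ℝ)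
  have hpt : ((A : GL (Fin 2) ℝ) • ofComplex (z : ℂ)) = A • z := by rw [ofComplex_apply]; rfl
  have h2 := hf.hasFDerivAt (A • z)
  rw [← hpt] at h2
  have h3 := h2.comp (z : ℂ) h1
  have h4 := (congruence B).hasFDerivAt.comp (z : ℂ) (hf.hasFDerivAt z)
  have e : planeEntries f ∘ (fun w : ℂ => (((A : GL (Fin 2) ℝ) • ofComplex w : ℍ) : ℂ)) =
      congruence B ∘ planeEntries f := by
    funext w
    simp only [Function.comp_apply, planeEntries, ofComplex_apply, congruence_entries]
    rw [← hAB]; rfl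
  rw [e] at h3
  have h5 := congrArg (fun L => L v) (h3.unique h4)
  rw [hpt] at h5
  simpa [mul_comm] using h5

theorem SmoothMap.schattenNorm_smul {f : ℍ → HypThree} (hf : SmoothMap f) {A : SL(2, ℝ)}
    {B : SL(2, ℂ)} (hAB : ∀ z, f (A • z) = B • f z) (z : ℍ) :
    schattenNorm f (A • z) = schattenNorm f z := by
  set q := denom (A : GL (Fin 2) ℝ) z with hq
  have hq0 : q ≠ 0 := denom_ne_zero _ z
  have him : (A • z).im = z.im / Complex.normSq q := by
    have h := im_smul_eq_div_normSq (A : GL (Fin 2) ℝ) z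
    rw [← hq] at h
    have h2 : ((A : GL (Fin 2) ℝ) • z).im = z.im / Complex.normSq q := by simpa using h
    exact h2
  set L := differential f (A • z)
  -- The Möbius map has derivative `q⁻²` and divides heights by `|q|²`. The quotient `p` is a unit
  -- complex number: the rotation between the image of the frame at `z` and the frame at `A • z`.
  set p := (q ^ 2)⁻¹ * Complex.normSq q with hp
  have hpn : p.re ^ 2 + p.im ^ 2 = 1 := by
    have h : Complex.normSq p = 1 := by
      rw [hp, Complex.normSq_mul, Complex.normSq_inv, Complex.normSq_ofReal, map_pow]
      have := Complex.normSq_pos.2 hq0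
      field_simp
    rw [Complex.normSq_apply] at h
    linarith
  have hn : (Complex.normSq q : ℂ) ≠ 0 := by exact_mod_cast (Complex.normSq_pos.2 hq0).ne'
  have hpre : (p.re : ℂ) + p.im * Complex.I = (q ^ 2)⁻¹ * Complex.normSq q := Complex.re_add_im p
  have hfr : (q ^ 2)⁻¹ * (z.im : ℂ) = ((p.re : ℂ) + p.im * Complex.I) * ((A • z).im : ℂ) := by
    rw [hpre, him, Complex.ofReal_div]
    field_simp
  have hL : ∀ v, congruence B (differential f z v) = L ((q ^ 2)⁻¹ * v) :=
    fun v => (hf.differential_smul hAB z v).symm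
  have e0 : congruence B (differential f z (orthonormalFrame z 0)) =
      p.re • L (orthonormalFrame (A • z) 0) + p.im • L (orthonormalFrame (A • z) 1) := by
    rw [hL, ← map_smul, ← map_smul, ← map_add]
    congr 1
    simp only [orthonormalFrame, Matrix.cons_val, Complex.real_smul]
    linear_combination hfr
  have e1 : congruence B (differential f z (orthonormalFrame z 1)) =
      (-p.im) • L (orthonormalFrame (A • z) 0) + p.re • L (orthonormalFrame (A • z) 1) := by
    rw [hL, ← map_smul, ← map_smul, ← map_add]
    congr 1
    simp only [orthonormalFrame, Matrix.cons_val, Complex.real_smul, Complex.ofReal_neg]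
    linear_combination Complex.I * hfr + (p.im : ℂ) * ((A • z).im : ℂ) * Complex.I_sq
  have hform : ∀ i j, pullbackGram f z i j =
      hypThreeForm (Matrix.of (congruence B (differential f z (orthonormalFrame z i))))
        (Matrix.of (congruence B (differential f z (orthonormalFrame z j)))) := by
    intro i j
    rw [of_congruence, of_congruence, hypThreeForm_conj]
    rfl
  have hlin : ∀ (a b a' b' : ℝ) (U V : Fin 2 → Fin 2 → ℂ),
      hypThreeForm (Matrix.of (a • U + b • V)) (Matrix.of (a' • U + b' • V)) =
        a * a' * hypThreeForm (Matrix.of U) (Matrix.of U) +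
        (a * b' + b * a') * hypThreeForm (Matrix.of U) (Matrix.of V) +
        b * b' * hypThreeForm (Matrix.of V) (Matrix.of V) := by
    intro a b a' b' U V
    rw [← Matrix.of_add_of, ← Matrix.of_add_of, ← Matrix.smul_of, ← Matrix.smul_of,
      ← Matrix.smul_of, ← Matrix.smul_of, hypThreeForm_add_left, hypThreeForm_smul_left,
      hypThreeForm_smul_left, hypThreeForm_comm _ (a' • Matrix.of U + b' • Matrix.of V),
      hypThreeForm_comm (Matrix.of V) (a' • Matrix.of U + b' • Matrix.of V),
      hypThreeForm_add_left, hypThreeForm_smul_left,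
      hypThreeForm_smul_left, hypThreeForm_add_left, hypThreeForm_smul_left,
      hypThreeForm_smul_left, hypThreeForm_comm (Matrix.of V) (Matrix.of U)]
    ring
  rw [hf.schattenNorm_eq_gramNuclear, hf.schattenNorm_eq_gramNuclear,
    ← gramNuclear_rotate _ _ _ _ _ hpn, hform, hform, hform, e0, e1, hlin, hlin, hlin]
  congr 1 <;> simp only [pullbackGram, Matrix.of_apply] <;> ring

/-! ### Closed hyperbolic surfaces: finite area, integrability -/

/-- Hyperbolic area has a positive density with respect to Lebesgue measure. This turns a strict
inequality on a nonempty open set into a strict inequality of energies. -/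
instance : (volume : Measure ℍ).IsOpenPosMeasure where
  open_pos U hU hne h := by
    rw [volume_eq_lintegral] at h
    have hI : IsOpen (UpperHalfPlane.coe '' U) := isOpenEmbedding_coe.isOpenMap U hU
    have hpos : 0 < volume (UpperHalfPlane.coe '' U) := hI.measure_pos _ (hne.image _)
    refine hpos.ne' ?_
    rw [lintegral_eq_zero_iff (by fun_prop)] at h
    rw [Filter.EventuallyEq, ae_restrict_iff' hI.measurableSet] at h
    rw [measure_eq_zero_iff_ae_notMem]
    filter_upwards [h] with w hw hwU
    have h2 := hw hwU
    obtain ⟨z, -, rfl⟩ := hwU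
    simp [z.im_ne_zero] at h2

namespace IsClosedHyperbolicSurface

variable {Γ : Type*} [Group Γ] [MulAction Γ ℍ]

theorem continuousConstSMul (hΓ : IsClosedHyperbolicSurface Γ) : ContinuousConstSMul Γ ℍ where
  continuous_const_smul γ := by
    obtain ⟨A, hA⟩ := hΓ.isometric γ
    simp only [hA]
    exact continuous_const_smul A

theorem smulInvariantMeasure (hΓ : IsClosedHyperbolicSurface Γ) :
    SMulInvariantMeasure Γ ℍ volume where
  measure_preimage_smul γ s hs := by
    obtain ⟨A, hA⟩ := hΓ.isometric γ
    simp only [hA]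
    exact measure_preimage_smul_of_nullMeasurableSet (G := GL (Fin 2) ℝ) hs.nullMeasurableSet
      (A : GL (Fin 2) ℝ)

/-- Proper discontinuity lets only finitely many elements send the point `I` into a given compact
set, and countably many compact sets cover the plane. -/
theorem countable (hΓ : IsClosedHyperbolicSurface Γ) : Countable Γ := by
  have := hΓ.properlyDiscontinuous
  rw [← Set.countable_univ_iff]
  have h : (Set.univ : Set Γ) ⊆
      ⋃ n, {γ : Γ | ((γ • ·) '' {I} ∩ compactCovering ℍ n).Nonempty} := by
    intro γ _
    obtain ⟨n, hn⟩ := exists_mem_compactCovering (γ • I)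
    exact Set.mem_iUnion.2 ⟨n, γ • I, ⟨I, rfl, rfl⟩, hn⟩
  exact (Set.countable_iUnion fun n => (ProperlyDiscontinuousSMul.finite_disjoint_inter_image
    isCompact_singleton (isCompact_compactCovering ℍ n)).countable).mono h

/-- A closed surface is covered by the translates of a compact set. -/
theorem exists_compact (hΓ : IsClosedHyperbolicSurface Γ) :
    ∃ K : Set ℍ, IsCompact K ∧ ∀ z : ℍ, ∃ γ : Γ, γ • z ∈ K := by
  have := hΓ.continuousConstSMul
  have := hΓ.compactQuotient
  let K : CompactExhaustion ℍ := default
  let π : ℍ → MulAction.orbitRel.Quotient Γ ℍ := Quotient.mk _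
  have hπ : IsOpenMap π := isOpenMap_quotient_mk'_mul
  obtain ⟨n, hn⟩ := isCompact_univ.elim_directed_cover (fun n => π '' interior (K n))
    (fun n => hπ _ isOpen_interior) (fun q _ => by
      obtain ⟨z, rfl⟩ := Quotient.exists_rep q
      obtain ⟨n, hn⟩ := K.exists_mem_nhds z
      exact Set.mem_iUnion.2 ⟨n, z, mem_interior_iff_mem_nhds.2 hn, rfl⟩)
    (directed_of_isDirected_le fun m n h => Set.image_mono (interior_mono (K.subset h)))
  refine ⟨K n, K.isCompact n, fun z => ?_⟩
  obtain ⟨w, hw, hwz⟩ := hn (Set.mem_univ (π z))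
  obtain ⟨γ, hγ⟩ := MulAction.orbitRel_apply.1 (Quotient.exact hwz)
  exact ⟨γ, by simpa [hγ] using interior_subset hw⟩

variable {D : Set ℍ}

open scoped Pointwise in
-- The domain `D` need not be bounded. Its area is bounded by that of a compact `K` whose translates
-- cover the plane, by unfolding `K` over the translates of `D`.
theorem volume_lt_top (hΓ : IsClosedHyperbolicSurface Γ)
    (hD : IsFundamentalDomain Γ D (volume : Measure ℍ)) : volume D < ⊤ := by
  have := hΓ.continuousConstSMul
  have := hΓ.smulInvariantMeasure
  have := hΓ.countable
  obtain ⟨K, hK, hcov⟩ := hΓ.exists_compact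
  have h : D ⊆ ⋃ γ : Γ, (γ • K ∩ D) := by
    intro z hz
    obtain ⟨γ, hγ⟩ := hcov z
    exact Set.mem_iUnion.2 ⟨γ⁻¹, ⟨γ • z, hγ, inv_smul_smul _ _⟩, hz⟩
  calc volume D ≤ ∑' γ : Γ, volume (γ • K ∩ D) := (measure_mono h).trans (measure_iUnion_le _)
    _ = volume K := (hD.measure_eq_tsum K).symm
    _ < ⊤ := hK.measure_lt_top

theorem integrableOn (hΓ : IsClosedHyperbolicSurface Γ)
    (hD : IsFundamentalDomain Γ D (volume : Measure ℍ)) {φ : ℍ → ℝ} (hφ : Continuous φ)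
    (hinv : ∀ (γ : Γ) z, φ (γ • z) = φ z) : IntegrableOn φ D := by
  obtain ⟨K, hK, hcov⟩ := hΓ.exists_compact
  obtain ⟨C, hC⟩ := hK.exists_bound_of_continuousOn hφ.continuousOn
  refine Measure.integrableOn_of_bounded (M := C) (hΓ.volume_lt_top hD).ne
    hφ.aestronglyMeasurable (Filter.Eventually.of_forall fun z => ?_)
  obtain ⟨γ, hγ⟩ := hcov z
  rw [← hinv γ z]
  exact hC _ hγ

/-- An invariant set that is null in a fundamental domain is null everywhere, which is impossible
for a nonempty open set. -/
theorem volume_inter_pos (hΓ : IsClosedHyperbolicSurface Γ)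
    (hD : IsFundamentalDomain Γ D (volume : Measure ℍ)) {U : Set ℍ} (hU : IsOpen U)
    (hne : U.Nonempty) (hinv : ∀ (γ : Γ) z, z ∈ U → γ • z ∈ U) : 0 < volume (U ∩ D) := by
  have := hΓ.continuousConstSMul
  have := hΓ.smulInvariantMeasure
  have := hΓ.countable
  rw [pos_iff_ne_zero]
  intro h
  refine (hU.measure_pos volume hne).ne' (hD.measure_zero_of_invariant U (fun γ => ?_) h)
  apply Set.Subset.antisymm
  · rintro _ ⟨z, hz, rfl⟩
    exact hinv γ z hz
  · intro z hz
    exact ⟨γ⁻¹ • z, hinv _ z hz, smul_inv_smul _ _⟩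

/-! ### Strict convexity of the energy -/

variable {ρ : Γ →* PSLTwoC} {f g : ℍ → HypThree}

theorem schattenNorm_smul (hΓ : IsClosedHyperbolicSurface Γ) (hf : f ∈ equivariantMaps ρ) (γ : Γ)
    (z : ℍ) : schattenNorm f (γ • z) = schattenNorm f z := by
  obtain ⟨A, hA⟩ := hΓ.isometric γ
  obtain ⟨B, hB⟩ := QuotientGroup.mk_surjective (ρ γ)
  rw [hA]
  refine hf.1.schattenNorm_smul (B := B) (fun w => ?_) z
  rw [← hA, hf.2 γ w, ← hB, pslTwoC_mk_smul]

theorem integrableOn_schattenNorm (hΓ : IsClosedHyperbolicSurface Γ)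
    (hD : IsFundamentalDomain Γ D (volume : Measure ℍ)) (hf : f ∈ equivariantMaps ρ) :
    IntegrableOn (schattenNorm f) D :=
  hΓ.integrableOn hD hf.1.continuous_schattenNorm (hΓ.schattenNorm_smul hf)

end IsClosedHyperbolicSurface

/-! ### Convexity of the energy along geodesic homotopies, and critical points -/

section

variable {Γ : Type*} [Group Γ] [MulAction Γ ℍ] {D : Set ℍ} {ρ : Γ →* PSLTwoC} {f g : ℍ → HypThree}

theorem isEquivariant_geodMap (hf : f ∈ equivariantMaps ρ) (hg : g ∈ equivariantMaps ρ) (t : ℝ) :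
    IsEquivariant ρ (geodMap f g t) := fun γ z => by
  rw [geodMap, hf.2, hg.2, geodPoint_smul_psl, geodMap]

theorem geodMap_mem (hf : f ∈ equivariantMaps ρ) (hg : g ∈ equivariantMaps ρ) (t : ℝ) :
    geodMap f g t ∈ equivariantMaps ρ :=
  ⟨smoothMap_geodMap hf.1 hg.1 t, isEquivariant_geodMap hf hg t⟩

theorem geodMap_zero (f g : ℍ → HypThree) : geodMap f g 0 = f := funext fun _ => geodPoint_zero _ _

theorem geodMap_one (f g : ℍ → HypThree) : geodMap f g 1 = g := funext fun _ => geodPoint_one _ _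

/-- The geodesics extend to negative times, so the homotopy is a two-sided deformation. With `ε = 1`
its nonnegative times lie in the range of the convexity estimate. -/
theorem isDeformation_geodMap (hf : f ∈ equivariantMaps ρ) (hg : g ∈ equivariantMaps ρ) :
    IsDeformation ρ f 1 (geodMap f g) where
  pos := one_pos
  smooth := (contMDiff_geodMap hf.1 hg.1).contMDiffOn
  equivariant t _ := isEquivariant_geodMap hf hg t
  initial := geodMap_zero f g

theorem equivariantlyHomotopic_of_mem (hf : f ∈ equivariantMaps ρ) (hg : g ∈ equivariantMaps ρ) :
    EquivariantlyHomotopic ρ f g := by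
  refine ⟨geodMap f g, ?_, fun t _ => isEquivariant_geodMap hf hg t, geodMap_zero f g,
    geodMap_one f g⟩
  have h : Continuous (fun q : ℝ × ℍ => (geodMap f g q.1 q.2).entries) :=
    (contMDiff_geodMap hf.1 hg.1).continuous
  have h2 : Continuous (fun q : ℝ × ℍ => geodMap f g q.1 q.2) := continuous_induced_rng.2 h
  exact h2.continuousOn

/-- The energy is convex along geodesic homotopies. -/
theorem schattenEnergy_geodMap_le (hΓ : IsClosedHyperbolicSurface Γ)
    (hD : IsFundamentalDomain Γ D (volume : Measure ℍ)) (hf : f ∈ equivariantMaps ρ)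
    (hg : g ∈ equivariantMaps ρ) {t : ℝ} (ht0 : 0 ≤ t) (ht1 : t ≤ 1) :
    schattenEnergy D (geodMap f g t) ≤
      (1 - t) * schattenEnergy D f + t * schattenEnergy D g := by
  have If := hΓ.integrableOn_schattenNorm hD hf
  have Ig := hΓ.integrableOn_schattenNorm hD hg
  have Ih := hΓ.integrableOn_schattenNorm hD (geodMap_mem hf hg t)
  unfold schattenEnergy
  rw [← integral_const_mul, ← integral_const_mul,
    ← integral_add (If.const_mul _) (Ig.const_mul _)]
  exact integral_mono Ih ((If.const_mul _).add (Ig.const_mul _))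
    (schattenNorm_geodMap_le hf.1 hg.1 ht0 ht1)

/-- The energy is strictly convex along geodesic homotopies that start at an immersion. -/
theorem schattenEnergy_geodMap_lt (hΓ : IsClosedHyperbolicSurface Γ)
    (hD : IsFundamentalDomain Γ D (volume : Measure ℍ)) (hf : f ∈ equivariantMaps ρ)
    (hg : g ∈ equivariantMaps ρ) (himm : IsImmersionMap f) (hne : g ≠ f) {t : ℝ} (ht0 : 0 < t)
    (ht1 : t < 1) :
    schattenEnergy D (geodMap f g t) <
      (1 - t) * schattenEnergy D f + t * schattenEnergy D g := by
  have If := hΓ.integrableOn_schattenNorm hD hf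
  have Ig := hΓ.integrableOn_schattenNorm hD hg
  have Ih := hΓ.integrableOn_schattenNorm hD (geodMap_mem hf hg t)
  have Is : IntegrableOn (fun z => (1 - t) * schattenNorm f z + t * schattenNorm g z) D :=
    (If.const_mul (1 - t)).add (Ig.const_mul t)
  have hle := schattenNorm_geodMap_le hf.1 hg.1 ht0.le ht1.le
  have hU : IsOpen {z | f z ≠ g z} := isOpen_ne_fun hf.1.continuous hg.1.continuous
  have hUne : {z | f z ≠ g z}.Nonempty := by
    by_contra! h
    exact hne (funext fun z => by
      by_contra hz
      exact (h ▸ (show z ∈ {z | f z ≠ g z} from fun e => hz e.symm) : z ∈ (∅ : Set ℍ)))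
  have hUinv : ∀ (γ : Γ) z, z ∈ {z | f z ≠ g z} → γ • z ∈ {z | f z ≠ g z} := by
    intro γ z hz h
    rw [hf.2, hg.2] at h
    exact hz (MulAction.injective _ h)
  have hpos := hΓ.volume_inter_pos hD hU hUne hUinv
  unfold schattenEnergy
  rw [← integral_const_mul, ← integral_const_mul,
    ← integral_add (If.const_mul _) (Ig.const_mul _), ← sub_pos, ← integral_sub Is Ih]
  -- The convexity defect is nonnegative everywhere and positive on the open invariant set where the
  -- maps differ, which meets `D` in positive area.
  rw [integral_pos_iff_support_of_nonneg (fun z => sub_nonneg.2 (hle z)) (Is.sub Ih)]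
  refine lt_of_lt_of_le ?_ (measure_mono (s := {z | f z ≠ g z}) fun z hz => ?_)
  · rwa [Measure.restrict_apply hU.measurableSet]
  · exact (sub_pos.2 (schattenNorm_geodMap_lt hf.1 hg.1 ht0 ht1 (himm z) hz)).ne'

/-- The difference quotients from the right are at most `-c`, so they cannot tend to `0`. -/
theorem not_isCriticalPoint_of_le {ε c : ℝ} {φ : ℝ → ℍ → HypThree} (hφ : IsDeformation ρ g ε φ)
    (hc : 0 < c)
    (h : ∀ t ∈ Set.Ico 0 ε, schattenEnergy D (φ t) ≤ schattenEnergy D g - c * t) :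
    ¬ IsCriticalPoint D ρ g := by
  intro hg
  have hd := (hg.2 ε φ hφ).hasDerivWithinAt (s := Set.Ioi 0)
  rw [hasDerivWithinAt_iff_tendsto_slope' (by simp)] at hd
  have hev : ∀ᶠ t in nhdsWithin (0 : ℝ) (Set.Ioi 0),
      slope (fun t => schattenEnergy D (φ t)) 0 t ≤ -c := by
    filter_upwards [Ioo_mem_nhdsGT hφ.pos] with t ht
    have := h t ⟨ht.1.le, ht.2⟩
    rw [slope_def_field, hφ.initial, sub_zero, div_le_iff₀ ht.1]
    linarith
  have := le_of_tendsto hd hev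
  linarith

/-- A critical point minimizes the energy. -/
theorem IsCriticalPoint.schattenEnergy_le (hΓ : IsClosedHyperbolicSurface Γ)
    (hD : IsFundamentalDomain Γ D (volume : Measure ℍ)) (hf : IsCriticalPoint D ρ f)
    (hg : g ∈ equivariantMaps ρ) : schattenEnergy D f ≤ schattenEnergy D g := by
  by_contra! h
  refine not_isCriticalPoint_of_le (isDeformation_geodMap hf.1 hg) (sub_pos.2 h)
    (fun t ht => ?_) hf
  have := schattenEnergy_geodMap_le hΓ hD hf.1 hg ht.1 ht.2.le
  linarith

/-- An immersion of minimal energy has less energy than every other map. -/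
theorem IsMinimizing.schattenEnergy_lt (hΓ : IsClosedHyperbolicSurface Γ)
    (hD : IsFundamentalDomain Γ D (volume : Measure ℍ)) (hf : IsMinimizing D ρ f)
    (himm : IsImmersionMap f) (hg : g ∈ equivariantMaps ρ) (hne : g ≠ f) :
    schattenEnergy D f < schattenEnergy D g := by
  -- The midpoint has energy below the mean of the two energies and, by minimality, at least that of
  -- `f`; any interior time would do.
  have h1 := schattenEnergy_geodMap_lt hΓ hD hf.1 hg himm hne (t := 1 / 2) (by norm_num)
    (by norm_num)
  have h2 := hf.2 _ (geodMap_mem hf.1 hg (1 / 2))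
  linarith

end

end

theorem mainTheorem5 {Γ : Type*} [Group Γ] [MulAction Γ ℍ] (hΓ : IsClosedHyperbolicSurface Γ)
    (D : Set ℍ) (hD : IsFundamentalDomain Γ D (volume : Measure ℍ))
    (ρ : Γ →* PSLTwoC) (f : ℍ → HypThree) (hf : f ∈ equivariantMaps ρ) (himm : IsImmersionMap f) :
    (∀ g ∈ equivariantMaps ρ, EquivariantlyHomotopic ρ f g) ∧
    (IsCriticalPoint D ρ f →
      (∀ g, IsCriticalPoint D ρ g ↔ g = f) ∧
      (∀ g ∈ equivariantMaps ρ, g ≠ f → schattenEnergy D f < schattenEnergy D g) ∧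
      (∀ g ∈ equivariantMaps ρ, g ≠ f →
        ∃ (ε : ℝ) (φ : ℝ → ℍ → HypThree) (c : ℝ), IsDeformation ρ g ε φ ∧ 0 < c ∧
          ∀ t ∈ Set.Ico 0 ε, schattenEnergy D (φ t) ≤ schattenEnergy D g - c * t)) ∧
    (IsMinimizing D ρ f → ∀ g, IsMinimizing D ρ g ↔ g = f) := by
  refine ⟨fun g hg => equivariantlyHomotopic_of_mem hf hg, fun hcrit => ?_, fun hmin g => ?_⟩
  · have hmin : IsMinimizing D ρ f := ⟨hf, fun g hg => hcrit.schattenEnergy_le hΓ hD hg⟩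
    have hlt : ∀ g ∈ equivariantMaps ρ, g ≠ f → schattenEnergy D f < schattenEnergy D g :=
      fun g hg hne => hmin.schattenEnergy_lt hΓ hD himm hg hne
    have hdec : ∀ g ∈ equivariantMaps ρ, g ≠ f →
        ∃ (ε : ℝ) (φ : ℝ → ℍ → HypThree) (c : ℝ), IsDeformation ρ g ε φ ∧ 0 < c ∧
          ∀ t ∈ Set.Ico 0 ε, schattenEnergy D (φ t) ≤ schattenEnergy D g - c * t := by
      intro g hg hne
      -- The deformation runs from `g` towards `f`. As `g` need not be an immersion, only weak
      -- convexity is used; the rate is positive because `f` is the strict minimum.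
      refine ⟨1, geodMap g f, schattenEnergy D g - schattenEnergy D f,
        isDeformation_geodMap hg hf, sub_pos.2 (hlt g hg hne), fun t ht => ?_⟩
      have := schattenEnergy_geodMap_le hΓ hD hg hf ht.1 ht.2.le
      linarith
    refine ⟨fun g => ⟨fun hg => ?_, fun h => h ▸ hcrit⟩, hlt, hdec⟩
    by_contra hne
    obtain ⟨ε, φ, c, hφ, hc, h⟩ := hdec g hg.1 hne
    exact not_isCriticalPoint_of_le hφ hc h hg
  · refine ⟨fun hg => ?_, fun h => h ▸ hmin⟩
    by_contra hne
    exact (hmin.schattenEnergy_lt hΓ hD himm hg.1 hne).not_ge (hg.2 f hf)
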